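/- Definitions. All spaces are $T_1$. For a point $x$ of a topological space $X$, a family $\mathcal N$ of subsets of $X$ is a $\mathrm{cs}^*$-network at $x$ if for every neighborhood $U$ of $x$ and every sequence $(x_n)$ converging to $x$ there is $N\in\mathcal N$ with $N\subset U$ containing infinitely many members of $(x_n)$; it is an $\mathrm{sb}$-network at $x$ if every neighborhood of $x$ contains some $N\in\mathcal N$ with $x\in N$, and every $N\in\mathcal N$ contains all but finitely many members of each sequence converging to $x$. The cardinals $\mathrm{cs}^*_\chi(X)$ and $\mathrm{sb}_\chi(X)$ are the suprema over $x\in X$ of the smallest sizes of such networks at $x$; $X$ has countable $\mathrm{cs}^*$-character if $\mathrm{cs}^*_\chi(X)\le\aleph_0$. For $A\subset X$ let $A^{(0)}=A$ and, for an ordinal $\alpha>0$, $A^{(\alpha)}=\bigcup_{\beta<\alpha}(A^{(\beta)})^{(1)}$, where $B^{(1)}$ is the set of limits of sequences in $B$ that converge in $X$; the sequential order $\mathrm{so}(X)$ is the smallest ordinal $\alpha$ with $A^{(\alpha+1)}=A^{(\alpha)}$ for all $A\subset X$. The cardinal $\mathfrak d$ is the cofinality of $\mathbb N^\omega$ with the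 pointwise order. The $k$-ness $k(X)$ of a $k$-space $X$ is the smallest size of a cover $\mathcal K$ of $X$ by compact subsets such that a set $F\subset X$ is closed iff $F\cap K$ is closed in $K$ for all $K\in\mathcal K$. The boundedness index $ib(G)$ of a topological group $G$ is the smallest cardinal $\kappa$ such that for every nonempty open $U\subset G$ there is $F\subset G$ with $|F|\le\kappa$ and $G=F\cdot U$. A countable infinite set $S\subset X$ converges to $x$ if $S\setminus U$ is finite for each neighborhood $U$ of $x$; $X$ is an $\alpha_7$-space if for any countable infinite sets $S_n\subset X$, $n\in\omega$, converging to a common point there is a countable infinite set $S\subset X$ converging to some point of $X$ with $S\cap S_n\neq\emptyset$ for infinitely many $n$. The Arens space $S_2$ is the set $\{(0,0),(\frac1n,0),(\frac1n,\frac1{nm}):n,m\in\mathbb N\}$ with the strongest topology inducing the planar topology on $C_0=\{(0,0),(\frac1n,0):n\in\mathbb N\}$ and on each $C_n=\{(\frac1n,0),(\frac1n,\frac1{nm}):m\in\mathbb N\}$, and the sequential fan is the quotient space $S_\omega=S_2/C_0$. A topological group is Weil complete if it is complete in its left uniformity. Theorem. Let $G$ be a ($T_1$) topological group whose underlying space is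 sequential and has countable $\mathrm{cs}^*$-character. Then $G$ is metrizable if at least one of the following conditions is satisfied: (1) $\mathrm{so}(G)<\omega_1$; (2) $\mathrm{sb}_\chi(G)<\mathfrak d$; (3) $ib(G)<k(G)$; (4) $G$ is Fréchet–Urysohn; (5) $G$ is an $\alpha_7$-space; (6) $G$ contains no closed copy of $S_\omega$, or $G$ contains no closed copy of $S_2$ (in particular, if it contains neither); (7) $G$ is not Weil complete; (8) $G$ is a Baire space; (9) $ib(G)<|G|<2^{\aleph_0}$. -/

import Mathlib

open Filter Topology Set
open scoped Cardinal Ordinal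

universe u

namespace SeqGroup

section Characters

variable {X : Type u} [TopologicalSpace X]

/-- `𝒩` is a `cs*`-network at `x`: for every neighbourhood `U` of `x` and every sequence
converging to `x`, some `N ∈ 𝒩` with `N ⊆ U` contains infinitely many members of the sequence. -/
def IsCsStarNetworkAt (𝒩 : Set (Set X)) (x : X) : Prop :=
  ∀ U ∈ 𝓝 x, ∀ a : ℕ → X, Tendsto a atTop (𝓝 x) →
    ∃ N ∈ 𝒩, N ⊆ U ∧ ∃ᶠ n in atTop, a n ∈ N

/-- `B` is a sequential barrier at `x`: every sequence converging to `x` is eventually in `B`. -/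
def IsSeqBarrier (B : Set X) (x : X) : Prop :=
  ∀ a : ℕ → X, Tendsto a atTop (𝓝 x) → ∀ᶠ n in atTop, a n ∈ B

/-- `𝒩` is an `sb`-network at `x`: a network at `x` consisting of sequential barriers at `x`. -/
def IsSbNetworkAt (𝒩 : Set (Set X)) (x : X) : Prop :=
  (∀ N ∈ 𝒩, IsSeqBarrier N x) ∧ ∀ U ∈ 𝓝 x, ∃ N ∈ 𝒩, x ∈ N ∧ N ⊆ U

/-- The `cs*`-character of `X` at `x`. -/
noncomputable def csStarCharacterAt (x : X) : Cardinal.{u} :=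
  sInf {κ | ∃ 𝒩 : Set (Set X), IsCsStarNetworkAt 𝒩 x ∧ #𝒩 = κ}

/-- The `sb`-character of `X` at `x`. -/
noncomputable def sbCharacterAt (x : X) : Cardinal.{u} :=
  sInf {κ | ∃ 𝒩 : Set (Set X), IsSbNetworkAt 𝒩 x ∧ #𝒩 = κ}

variable (X)

/-- The `cs*`-character of `X`. The characters at points are at least `1`, so `max 1` only
implements the convention that the empty space has `cs*`-character `1`. -/
noncomputable def csStarCharacter : Cardinal.{u} :=
  max 1 (⨆ x : X, csStarCharacterAt x)

/-- The `sb`-character of `X` (equal to `1` for the empty space). -/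
noncomputable def sbCharacter : Cardinal.{u} :=
  max 1 (⨆ x : X, sbCharacterAt x)

/-- `X` carries the inductive topology with respect to `𝒞`: a set `F` is closed in `X` iff
`F ∩ C` is closed in the subspace `C` for each `C ∈ 𝒞`. -/
def IsInductiveTopology (𝒞 : Set (Set X)) : Prop :=
  ∀ F : Set X, IsClosed F ↔ ∀ C ∈ 𝒞, IsClosed (Subtype.val ⁻¹' F : Set C)

/-- The `k`-ness of a `k`-space `X`: the smallest size of a cover of `X` by compact subsets with
respect to which `X` carries the inductive topology. -/
noncomputable def kness : Cardinal.{u} :=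
  sInf {κ | ∃ 𝒦 : Set (Set X), (∀ K ∈ 𝒦, IsCompact K) ∧ ⋃₀ 𝒦 = univ ∧
    IsInductiveTopology X 𝒦 ∧ #𝒦 = κ}

variable {X}

/-- The `α`-th sequential closure: `A⁽⁰⁾ = A` and, for `α > 0`, `A⁽ᵅ⁾` is the union over `β < α`
of the sets of limits of sequences in `A⁽ᵝ⁾` (for `α > 0` this union already contains `A`). -/
noncomputable def iterSeqClosure (A : Set X) (α : Ordinal.{u}) : Set X :=
  A ∪ ⋃ β : Iio α, seqClosure (iterSeqClosure A β.1)
termination_by α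
decreasing_by exact β.2

variable (X)

/-- The sequential order of `X`. -/
noncomputable def seqOrder : Ordinal.{u} :=
  sInf {α | ∀ A : Set X, iterSeqClosure A (α + 1) = iterSeqClosure A α}

variable {X}

/-- A set `S` seen as a sequence converging to `x`: `S` is countably infinite and `S \ U` is
finite for every neighbourhood `U` of `x`. -/
def SetConvergesTo (S : Set X) (x : X) : Prop :=
  S.Countable ∧ S.Infinite ∧ ∀ U ∈ 𝓝 x, (S \ U).Finite

variable (X)

/-- `α₇`-spaces: for any sequences `S n` converging to the same point there is a sequence `T`
converging to some point and meeting infinitely many of the `S n`. -/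
def IsAlphaSeven : Prop :=
  ∀ (x : X) (S : ℕ → Set X), (∀ n, SetConvergesTo (S n) x) →
    ∃ (T : Set X) (y : X), SetConvergesTo T y ∧ {n | (S n ∩ T).Nonempty}.Infinite

end Characters

/-- The cardinal `𝔡`: the cofinality of `ℕ → ℕ` with the pointwise (everywhere) order. -/
noncomputable def dominatingNumber : Cardinal.{0} := Order.cof (ℕ → ℕ)

/-- The boundedness index of a topological group. -/
noncomputable def boundednessIndex (G : Type u) [Group G] [TopologicalSpace G] : Cardinal.{u} :=
  sInf {κ | ∀ U : Set G, IsOpen U → U.Nonempty →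
    ∃ F : Set G, #F ≤ κ ∧ (univ : Set G) = Set.image2 (fun x y => x * y) F U}

/-- The points of the Arens space: `center` is `(0, 0)`, `mid n` is `(1/(n+1), 0)`, and `leaf n m`
is `(1/(n+1), 1/((n+1)(m+1)))`. -/
inductive ArensSpace : Type
  | center : ArensSpace
  | mid (n : ℕ) : ArensSpace
  | leaf (n m : ℕ) : ArensSpace

/-- The topology of the Arens space `S₂`, the strongest one that induces on
`C₀ = {center} ∪ {mid n | n}` and on each `{mid n} ∪ {leaf n m | m}` the topology of a sequence
converging to `center`, respectively to `mid n`: a set is open iff its traces on all these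
convergent sequences are open in them. -/
instance : TopologicalSpace ArensSpace where
  IsOpen U := (ArensSpace.center ∈ U → ∀ᶠ n in atTop, ArensSpace.mid n ∈ U) ∧
    ∀ n, ArensSpace.mid n ∈ U → ∀ᶠ m in atTop, ArensSpace.leaf n m ∈ U
  isOpen_univ := ⟨fun _ => Eventually.of_forall fun _ => mem_univ _,
    fun _ _ => Eventually.of_forall fun _ => mem_univ _⟩
  isOpen_inter _ _ hs ht := ⟨fun h => (hs.1 h.1).and (ht.1 h.2),
    fun n h => (hs.2 n h.1).and (ht.2 n h.2)⟩
  isOpen_sUnion 𝒰 h := by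
    refine ⟨?_, fun n => ?_⟩
    · rintro ⟨U, hU, hx⟩
      exact ((h U hU).1 hx).mono fun _ hn => ⟨U, hU, hn⟩
    · rintro ⟨U, hU, hx⟩
      exact ((h U hU).2 n hx).mono fun _ hn => ⟨U, hU, hn⟩

/-- The sequence `C₀ = {center} ∪ {mid n | n}` in the Arens space. -/
def ArensSpace.baseSeq : Set ArensSpace := insert ArensSpace.center (range ArensSpace.mid)

/-- The equivalence relation on the Arens space that identifies the points of `C₀`. -/
def ArensSpace.fanSetoid : Setoid ArensSpace where
  r p q := p = q ∨ (p ∈ ArensSpace.baseSeq ∧ q ∈ ArensSpace.baseSeq)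
  iseqv := by
    refine ⟨fun _ => Or.inl rfl, ?_, ?_⟩
    · rintro p q (h | h)
      · exact Or.inl h.symm
      · exact Or.inr ⟨h.2, h.1⟩
    · rintro p q r (rfl | h) (rfl | h')
      · exact Or.inl rfl
      · exact Or.inr h'
      · exact Or.inr h
      · exact Or.inr ⟨h.1, h'.2⟩

/-- The sequential fan `S_ω = S₂ / C₀`, with the quotient topology. -/
abbrev SeqFan : Type := Quotient ArensSpace.fanSetoid

/-- `X` contains a closed copy of `S`: a closed subspace homeomorphic to `S`. -/
def HasClosedCopy (S : Type*) [TopologicalSpace S] (X : Type*) [TopologicalSpace X] : Prop :=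
  ∃ f : S → X, IsClosedEmbedding f

/-- Weil completeness: completeness with respect to the left uniformity. -/
def IsWeilComplete (G : Type*) [Group G] [TopologicalSpace G] [IsTopologicalGroup G] : Prop :=
  @CompleteSpace G (IsTopologicalGroup.leftUniformSpace G)

end SeqGroup

/-! ### Preliminaries on sequences and networks -/

namespace SeqGroup

open scoped Pointwise

/-! A non-metrizable group of this class has a structure that contradicts each of the conditions.
Two objects carry the argument: a fan at `1`, and an increasing sequence of compact metrizable sets
`K n` whose union is an open subgroup.

The fan comes from a dichotomy (`exists_barrierNetwork_or_isFan`). Either finite unions of members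
of a countable `cs*`-network at `1` supply countably many sequential barriers inside arbitrary
neighbourhoods of `1`, or there are rows converging to `1` that can be thinned so that no selection
from infinitely many rows converges. In the first case a diagonal argument makes the barriers
neighbourhoods (`IsBarrierNetwork.eventually_nhdsWithin`), and Birkhoff–Kakutani gives a metric.

A fan yields closed copies of `S_ω` and, after translating its rows along row `0`, of `S₂`. It also
refutes the Fréchet–Urysohn and `α₇` properties and forces the `sb`-character up to `𝔡`.

Multiplying a fan by sequences that tend uniformly to `1` shows that some of these have convergent
subsequences (`IsFan.exists_subseq_tendsto`). Hence enough finite intersections of a closed network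
are sequentially compact, and their products form the exhaustion `K n`. The dichotomy, applied now
inside a sequentially compact set, where no fan fits, makes each `K n` compact metrizable. The
exhaustion settles the Baire, `k`-ness, cardinality and Weil completeness conditions. Fan and
exhaustion together produce, by transfinite recursion, sets of arbitrarily large countable
sequential order. -/

theorem exists_strictMono_comp_or_const (f : ℕ → ℕ) :
    (∃ φ : ℕ → ℕ, StrictMono φ ∧ StrictMono (f ∘ φ)) ∨
      ∃ (c : ℕ) (φ : ℕ → ℕ), StrictMono φ ∧ ∀ j, f (φ j) = c := by
  by_cases h : Tendsto f atTop atTop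
  · exact Or.inl (strictMono_subseq_of_tendsto_atTop h)
  · right
    by_contra! hc
    apply h
    rw [tendsto_atTop]
    intro b
    have : ∀ c ∈ Iio b, ∀ᶠ n in atTop, f n ≠ c := by
      intro c _
      by_contra hf
      obtain ⟨φ, hφ, h'⟩ := extraction_of_frequently_atTop (not_eventually.1 hf)
      obtain ⟨j, hj⟩ := hc c φ hφ
      exact h' j hj
    filter_upwards [(eventually_all_finite (finite_Iio b)).2 this] with n hn
    by_contra hlt
    exact hn (f n) (not_le.1 hlt) rfl

/-- Hall's theorem for subsets of `n + 1` elements of `A n`: a finite index set with maximum `k`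
already sees `k + 1` points. -/
theorem exists_injective_selection {X : Type*} {A : ℕ → Set X} (hA : ∀ n, (A n).Infinite) :
    ∃ f : ℕ → X, Function.Injective f ∧ ∀ n, f n ∈ A n := by
  classical
  choose t ht hcard using fun n => (hA n).exists_subset_card_eq (n + 1)
  obtain ⟨f, hf, hft⟩ := (Finset.all_card_le_biUnion_card_iff_exists_injective t).1 (by
    intro s
    rcases s.eq_empty_or_nonempty with rfl | hs
    · simp
    · calc s.card ≤ (Finset.range (s.max' hs + 1)).card :=
            Finset.card_le_card fun x hx =>
              Finset.mem_range.2 (Nat.lt_succ_of_le (s.le_max' x hx))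
        _ = (t (s.max' hs)).card := by rw [hcard, Finset.card_range]
        _ ≤ _ := Finset.card_le_card (Finset.subset_biUnion_of_mem t (s.max'_mem hs)))
  exact ⟨f, hf, fun n => ht n (hft n)⟩

/-- A sequence converging to `x` and avoiding `x` takes infinitely many values on every tail. -/
theorem infinite_image_of_tendsto {X : Type*} [TopologicalSpace X] [T1Space X] {a : ℕ → X} {x : X}
    (ha : Tendsto a atTop (𝓝 x)) (hx : ∀ n, a n ≠ x) {I : Set ℕ} (hI : I ∈ atTop) :
    (a '' I).Infinite := by
  intro hfin
  have h1 : ∀ᶠ n in atTop, a n ∈ (a '' I)ᶜ :=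
    ha (hfin.isClosed.isOpen_compl.mem_nhds (by rintro ⟨n, -, hn⟩; exact hx n hn))
  obtain ⟨n, hn, hn'⟩ := (h1.and hI).exists
  exact hn (mem_image_of_mem a hn')

theorem isOpen_of_forall_tendsto {X : Type*} [TopologicalSpace X] [SequentialSpace X] {O : Set X}
    (h : ∀ x ∈ O, ∀ a : ℕ → X, Tendsto a atTop (𝓝 x) → ∀ᶠ n in atTop, a n ∈ O) : IsOpen O := by
  rw [← isClosed_compl_iff]
  refine IsSeqClosed.isClosed fun a x ha hx hxO => ?_
  obtain ⟨n, hn⟩ := (h x hxO a hx).exists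
  exact ha n hn

theorem exists_isCsStarNetworkAt {X : Type u} [TopologicalSpace X]
    (h : csStarCharacter X ≤ ℵ₀) (x : X) :
    ∃ N : ℕ → Set X, ∀ U ∈ 𝓝 x, ∀ a : ℕ → X, Tendsto a atTop (𝓝 x) →
      ∃ i, N i ⊆ U ∧ ∃ᶠ n in atTop, a n ∈ N i := by
  have hx : csStarCharacterAt x ≤ ℵ₀ :=
    (le_ciSup (f := fun x : X => csStarCharacterAt x) Cardinal.bddAbove_of_small x).trans
      ((le_max_right _ _).trans h)
  have hne : {κ | ∃ 𝒩 : Set (Set X), IsCsStarNetworkAt 𝒩 x ∧ #𝒩 = κ}.Nonempty :=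
    ⟨_, univ, fun U hU a ha => ⟨U, mem_univ _, Subset.rfl, (ha.eventually_mem hU).frequently⟩, rfl⟩
  obtain ⟨𝒩, h𝒩, hc⟩ := csInf_mem hne
  have hcount : 𝒩.Countable := by
    rw [← Cardinal.le_aleph0_iff_set_countable, hc]; exact hx
  obtain ⟨N₀, hN₀, -⟩ := h𝒩 univ univ_mem (fun _ => x) tendsto_const_nhds
  obtain ⟨N, rfl⟩ := hcount.exists_eq_range ⟨N₀, hN₀⟩
  refine ⟨N, fun U hU a ha => ?_⟩
  obtain ⟨_, ⟨i, rfl⟩, h1, h2⟩ := h𝒩 U hU a ha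
  exact ⟨i, h1, h2⟩

/-! ### Fans and the metrizability dichotomy -/

section Fans

variable {G : Type u} [Group G] [TopologicalSpace G]

/-- A fan at `1`: a double sequence of distinct points different from `1` whose rows converge
to `1` and such that no selection from infinitely many rows converges. -/
structure IsFan (s : ℕ → ℕ → G) : Prop where
  tendsto_one : ∀ k, Tendsto (s k) atTop (𝓝 1)
  injective : ∀ {k m k' m'}, s k m = s k' m' → k = k' ∧ m = m'
  ne_one : ∀ k m, s k m ≠ 1
  not_tendsto : ∀ {φ : ℕ → ℕ} (m : ℕ → ℕ) (y : G), StrictMono φ →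
    ¬ Tendsto (fun j => s (φ j) (m j)) atTop (𝓝 y)

/-- `B` contains almost all members of every sequence in `L` that converges to `1`. -/
def IsBarrierIn (L B : Set G) : Prop :=
  ∀ a : ℕ → G, (∀ n, a n ∈ L) → Tendsto a atTop (𝓝 1) → ∀ᶠ n in atTop, a n ∈ B

/-- Every neighbourhood of `1` contains one of countably many barriers. -/
def IsBarrierNetwork (L : Set G) (B : ℕ → Set G) : Prop :=
  (∀ n, IsBarrierIn L (B n)) ∧ ∀ U ∈ 𝓝 (1 : G), ∃ n, B n ⊆ U

/-- The property of a sequence of sets to be a `cs*`-network at `1`. -/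
def IsCsStarSeq (N : ℕ → Set G) : Prop :=
  ∀ U ∈ 𝓝 (1 : G), ∀ a : ℕ → G, Tendsto a atTop (𝓝 1) →
    ∃ i, N i ⊆ U ∧ ∃ᶠ n in atTop, a n ∈ N i

/-- There are only countably many finite unions of the `N i`, so if each neighbourhood contained one
that is a barrier, they would form a barrier network. For a bad `U`, each finite union is left
infinitely often by some sequence in `L`; a subsequence avoiding it is a row. -/
theorem exists_rows_of_not_barrierNetwork {N : ℕ → Set G} (hN : IsCsStarSeq N) {L : Set G}
    (hL : ¬ ∃ B, IsBarrierNetwork L B) :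
    ∃ U ∈ 𝓝 (1 : G), ∃ r : ℕ → ℕ → G, ∀ k, Tendsto (r k) atTop (𝓝 1) ∧
      ∀ m, r k m ∈ L ∧ r k m ≠ 1 ∧ ∀ i < k, N i ⊆ U → r k m ∉ N i := by
  classical
  obtain ⟨U, hU, hUI⟩ : ∃ U ∈ 𝓝 (1 : G), ∀ I : Finset ℕ, (∀ i ∈ I, N i ⊆ U) →
      ¬ IsBarrierIn L (⋃ i ∈ I, N i) := by
    by_contra! hc
    apply hL
    obtain ⟨e, he⟩ := exists_surjective_nat (Finset ℕ)
    refine ⟨fun n => if IsBarrierIn L (⋃ i ∈ e n, N i) then ⋃ i ∈ e n, N i else univ,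
      fun n => ?_, fun U hU => ?_⟩
    · dsimp only
      split_ifs with h
      · exact h
      · exact fun _ _ _ => Eventually.of_forall fun _ => mem_univ _
    · obtain ⟨I, hI, hB⟩ := hc U hU
      obtain ⟨n, rfl⟩ := he I
      refine ⟨n, ?_⟩
      dsimp only
      rw [if_pos hB]
      exact iUnion₂_subset hI
  -- The constant sequence puts `1` into some `N i₀`. Including `i₀` in every finite union keeps the
  -- rows away from `1`.
  obtain ⟨i₀, hi₀, h1⟩ := hN U hU (fun _ => 1) tendsto_const_nhds
  have h1 : (1 : G) ∈ N i₀ := h1.exists.choose_spec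
  refine ⟨U, hU, ?_⟩
  have key : ∀ k : ℕ, ∃ r : ℕ → G, Tendsto r atTop (𝓝 1) ∧
      ∀ m, r m ∈ L ∧ r m ≠ 1 ∧ ∀ i < k, N i ⊆ U → r m ∉ N i := by
    intro k
    have h := hUI ((Finset.range (k + i₀ + 1)).filter fun i => N i ⊆ U)
      (fun i hi => (Finset.mem_filter.1 hi).2)
    unfold IsBarrierIn at h
    push Not at h
    obtain ⟨a, haL, ha, hf⟩ := h
    obtain ⟨φ, hφ, hn⟩ := extraction_of_frequently_atTop hf
    have hn' : ∀ m, ∀ i < k + i₀ + 1, N i ⊆ U → a (φ m) ∉ N i := by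
      intro m i hi hiU hmem
      exact hn m (mem_biUnion (x := i) (by simpa using ⟨by omega, hiU⟩) hmem)
    refine ⟨a ∘ φ, ha.comp hφ.tendsto_atTop, fun m => ⟨haL _, fun h => ?_, fun i hi => ?_⟩⟩
    · exact hn' m i₀ (by omega) hi₀ (by rw [show a (φ m) = 1 from h]; exact h1)
    · exact hn' m i (by omega)
  choose r hr using key
  exact ⟨r, hr⟩

variable [IsTopologicalGroup G] [T1Space G]

/-- A selection from infinitely many rows cannot tend to `1`, since some `N i ⊆ U` would contain
members of rows beyond `i`. If it tended to `y ≠ 1`, a small `N i` would contain infinitely many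
terms translated by `y⁻¹`, so quotients of terms would lie in `(N i)⁻¹ * N i`. Row `k` is thinned to
avoid the finitely many such quotient sets of index below `k` that stay away from `1`. -/
theorem exists_isFan_of_rows {N : ℕ → Set G} (hN : IsCsStarSeq N) {U : Set G} (hU : U ∈ 𝓝 (1 : G))
    {r : ℕ → ℕ → G} (hr : ∀ k, Tendsto (r k) atTop (𝓝 1)) (hr1 : ∀ k m, r k m ≠ 1)
    (hrN : ∀ k m, ∀ i < k, N i ⊆ U → r k m ∉ N i) :
    ∃ s : ℕ → ℕ → G, IsFan s ∧ ∀ k m, ∃ c, s k m = r k c := by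
  classical
  let S : ℕ → ℕ → ℕ → Set G := fun a b i => {g | ∃ u ∈ N i, ∃ v ∈ N i, (r a b)⁻¹ * g = u⁻¹ * v}
  -- Only those `S a b i` that do not accumulate at `1` can be avoided by a tail of a row; the
  -- others are replaced by `∅`.
  let E : ℕ → ℕ → ℕ → Set G := fun a b i => if (S a b i)ᶜ ∈ 𝓝 (1 : G) then S a b i else ∅
  have hE : ∀ a b i, (E a b i)ᶜ ∈ 𝓝 (1 : G) := by
    intro a b i
    by_cases h : (S a b i)ᶜ ∈ 𝓝 (1 : G)
    · simpa only [E, if_pos h] using h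
    · simp only [E, if_neg h, compl_empty, univ_mem]
  let J : ℕ → Set ℕ := fun k => {c | ∀ a ∈ Iio k, ∀ b ∈ Iio k, ∀ i ∈ Iio k, r k c ∉ E a b i}
  have hJ : ∀ k, J k ∈ atTop := fun k =>
    (eventually_all_finite (finite_Iio k)).2 fun a _ =>
    (eventually_all_finite (finite_Iio k)).2 fun b _ =>
    (eventually_all_finite (finite_Iio k)).2 fun i _ => (hr k).eventually_mem (hE a b i)
  obtain ⟨f, hf, hfA⟩ := exists_injective_selection
    (A := fun n => r n.unpair.1 '' (J n.unpair.1 ∩ Ici n.unpair.2))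
    (fun n => infinite_image_of_tendsto (hr _) (hr1 _) (inter_mem (hJ _) (Ici_mem_atTop _)))
  have hs : ∀ k m, ∃ c ∈ J k ∩ Ici m, r k c = f (Nat.pair k m) := by
    intro k m
    simpa using hfA (Nat.pair k m)
  choose c hc hcf using hs
  refine ⟨fun k m => r k (c k m), ⟨fun k => ?_, ?_, fun k m => hr1 _ _, ?_⟩, fun k m => ⟨_, rfl⟩⟩
  · exact (hr k).comp (tendsto_atTop_mono (fun m => (hc k m).2) tendsto_id)
  · intro k m k' m' h
    simp only [hcf] at h
    exact Nat.pair_eq_pair.1 (hf h)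
  · intro φ m y hφ hy
    by_cases hy1 : y = 1
    · subst hy1
      obtain ⟨i, hi, hfr⟩ := hN U hU _ hy
      obtain ⟨j, hj, hj'⟩ := (hfr.and_eventually (hφ.tendsto_atTop.eventually_gt_atTop i)).exists
      exact hrN _ _ i hj' hi hj
    · obtain ⟨W, hW, hWy⟩ : ∃ W ∈ 𝓝 (1 : G), ∀ a ∈ W, ∀ b ∈ W, ∀ c ∈ W, ∀ d ∈ W,
          y * a * b⁻¹ * c ≠ d := by
        have hcont : Tendsto (fun p : (G × G) × (G × G) => y * p.1.1 * p.1.2⁻¹ * p.2.1 * p.2.2⁻¹)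
            (𝓝 ((1, 1), (1, 1))) (𝓝 y) := by
          have : Continuous
              (fun p : (G × G) × (G × G) => y * p.1.1 * p.1.2⁻¹ * p.2.1 * p.2.2⁻¹) := by fun_prop
          simpa using this.tendsto ((1, 1), (1, 1))
        have hmem := hcont.eventually_ne hy1
        rw [nhds_prod_eq, nhds_prod_eq] at hmem
        obtain ⟨V, hV, hVy⟩ := mem_prod_self_iff.1 hmem
        obtain ⟨W, hW, hWV⟩ := mem_prod_self_iff.1 hV
        refine ⟨W, hW, fun a ha b hb c hc d hd h => ?_⟩
        refine hVy (a := ((a, b), (c, d))) ⟨hWV ⟨ha, hb⟩, hWV ⟨hc, hd⟩⟩ ?_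
        simp [h]
      have hy' : Tendsto (fun j => y⁻¹ * r (φ j) (c (φ j) (m j))) atTop (𝓝 1) := by
        simpa using hy.const_mul y⁻¹
      obtain ⟨i, hi, hfr⟩ := hN W hW _ hy'
      obtain ⟨j₀, hj₀⟩ := hfr.exists
      have hS : (S (φ j₀) (c (φ j₀) (m j₀)) i)ᶜ ∈ 𝓝 (1 : G) := by
        refine mem_of_superset hW fun d hd hdS => ?_
        obtain ⟨u, hu, v, hv, huv⟩ := hdS
        refine hWy _ (hi hj₀) u (hi hu) v (hi hv) d hd ?_
        rw [mul_assoc _ _ v, ← huv]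
        group
      obtain ⟨j, hj, h1, h2, h3⟩ := (hfr.and_eventually
        ((hφ.tendsto_atTop.eventually_gt_atTop (φ j₀)).and
        ((hφ.tendsto_atTop.eventually_gt_atTop (c (φ j₀) (m j₀))).and
        (hφ.tendsto_atTop.eventually_gt_atTop i)))).exists
      refine (hc (φ j) (m j)).1 (φ j₀) h1 (c (φ j₀) (m j₀)) h2 i h3 ?_
      simp only [E, if_pos hS]
      exact ⟨_, hj₀, _, hj, by group⟩

theorem exists_barrierNetwork_or_isFan {N : ℕ → Set G} (hN : IsCsStarSeq N) (L : Set G) :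
    (∃ B, IsBarrierNetwork L B) ∨ ∃ s : ℕ → ℕ → G, IsFan s ∧ ∀ k m, s k m ∈ L := by
  refine or_iff_not_imp_left.2 fun hL => ?_
  obtain ⟨U, hU, r, hr⟩ := exists_rows_of_not_barrierNetwork hN hL
  obtain ⟨s, hs, hsr⟩ := exists_isFan_of_rows hN hU (fun k => (hr k).1)
    (fun k m => ((hr k).2 m).2.1) (fun k m => ((hr k).2 m).2.2)
  refine ⟨s, hs, fun k m => ?_⟩
  obtain ⟨c, hc⟩ := hsr k m
  exact hc ▸ ((hr k).2 c).1

omit [T1Space G] in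
-- Barriers allow diagonal sequences: if `a j m` tends to `p j`, choose `m` with `(p j)⁻¹ * a j m`
-- in the first `j + 1` barriers; these quotients tend to `1`. So closures of subsets of `K` are
-- reached by single sequences, and a sequence leaving a translated barrier would contradict its
-- definition.
theorem IsBarrierNetwork.eventually_nhdsWithin [SequentialSpace G] {K L : Set G} {B : ℕ → Set G}
    (hB : IsBarrierNetwork L B) (hK : IsClosed K) (hKL : ∀ x ∈ K, ∀ y ∈ K, x⁻¹ * y ∈ L)
    {x : G} (hx : x ∈ K) (n : ℕ) : ∀ᶠ y in 𝓝[K] x, x⁻¹ * y ∈ B n := by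
  have hclosed : ∀ A ⊆ K, closure A ⊆ seqClosure A := by
    intro A hA
    refine closure_minimal subset_seqClosure (IsSeqClosed.isClosed ?_)
    intro p q hp hpq
    choose a haA ha using hp
    have hpK : ∀ j, p j ∈ K := fun j =>
      hK.isSeqClosed (fun m => hA (haA j m)) (ha j)
    have hex : ∀ j, ∃ m, ∀ i ∈ Iic j, (p j)⁻¹ * a j m ∈ B i := by
      intro j
      have ht : Tendsto (fun m => (p j)⁻¹ * a j m) atTop (𝓝 1) := by
        simpa using (ha j).const_mul (p j)⁻¹
      exact ((eventually_all_finite (finite_Iic j)).2 fun i _ =>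
        hB.1 i _ (fun m => hKL _ (hpK j) _ (hA (haA j m))) ht).exists
    choose m hm using hex
    have hz : Tendsto (fun j => (p j)⁻¹ * a j (m j)) atTop (𝓝 1) := by
      intro U hU
      obtain ⟨i, hi⟩ := hB.2 U hU
      rw [mem_map]
      filter_upwards [eventually_ge_atTop i] with j hj
      exact hi (hm j i hj)
    refine ⟨fun j => a j (m j), fun j => haA _ _, ?_⟩
    simpa using hpq.mul hz
  by_contra hf
  have hmem : x ∈ closure (K ∩ {y | x⁻¹ * y ∉ B n}) := by
    rw [mem_closure_iff_frequently]
    exact (frequently_nhdsWithin_iff.1 (not_eventually.1 hf)).mono fun y hy => ⟨hy.2, hy.1⟩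
  obtain ⟨a, ha, hax⟩ := hclosed _ inter_subset_left hmem
  have ht : Tendsto (fun m => x⁻¹ * a m) atTop (𝓝 1) := by
    simpa using hax.const_mul x⁻¹
  obtain ⟨m, hm⟩ := (hB.1 n _ (fun m => hKL _ hx _ (ha m).1) ht).exists
  exact (ha m).2 hm

theorem metrizableSpace_of_isCountablyGenerated (h : IsCountablyGenerated (𝓝 (1 : G))) :
    TopologicalSpace.MetrizableSpace G := by
  let _ := IsTopologicalGroup.leftUniformSpace G
  have : IsCountablyGenerated (uniformity G) :=
    inferInstanceAs (IsCountablyGenerated (comap (fun p : G × G => p.1⁻¹ * p.2) (𝓝 1)))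
  exact UniformSpace.metrizableSpace

theorem isCountablyGenerated_of_forall_exists_subset {X : Type*} {f : Filter X} {B : ℕ → Set X}
    (hB : ∀ n, B n ∈ f) (hf : ∀ U ∈ f, ∃ n, B n ⊆ U) : IsCountablyGenerated f := by
  refine HasCountableBasis.isCountablyGenerated (ι := ℕ) (p := fun _ => True) (s := B)
    ⟨⟨fun t => ⟨fun ht => ?_, ?_⟩⟩, to_countable _⟩
  · obtain ⟨n, hn⟩ := hf t ht
    exact ⟨n, trivial, hn⟩
  · rintro ⟨n, -, hn⟩
    exact mem_of_superset (hB n) hn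

/-- A sequential group with countable `cs*`-character is metrizable or contains a fan. -/
theorem exists_isFan_of_not_metrizableSpace [SequentialSpace G] {N : ℕ → Set G}
    (hN : IsCsStarSeq N) (hG : ¬ TopologicalSpace.MetrizableSpace G) :
    ∃ s : ℕ → ℕ → G, IsFan s := by
  obtain ⟨B, hB⟩ | ⟨s, hs, -⟩ := exists_barrierNetwork_or_isFan hN univ
  · refine (hG (metrizableSpace_of_isCountablyGenerated
      (isCountablyGenerated_of_forall_exists_subset (B := B) (fun n => ?_) hB.2))).elim
    simpa using hB.eventually_nhdsWithin isClosed_univ (fun _ _ _ _ => mem_univ _)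
      (mem_univ 1) n
  · exact ⟨s, hs⟩

end Fans

/-! ### Closed copies of the fan and Arens spaces, and direct consequences of a fan -/

section Copies

theorem exists_eq_or_of_tendsto_double {X : Type*} [TopologicalSpace X] [T2Space X]
    {l : ℕ → ℕ → X} {a : ℕ → X} (hl : ∀ n, Tendsto (l n) atTop (𝓝 (a n)))
    (hno : ∀ (φ m : ℕ → ℕ) (y : X), StrictMono φ → ¬ Tendsto (fun j => l (φ j) (m j)) atTop (𝓝 y))
    {n m : ℕ → ℕ} {y : X} (h : Tendsto (fun j => l (n j) (m j)) atTop (𝓝 y)) :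
    (∃ j, y = l (n j) (m j)) ∨
      ∃ c, y = a c ∧ ∃ φ : ℕ → ℕ, StrictMono φ ∧ StrictMono (m ∘ φ) ∧ ∀ j, n (φ j) = c := by
  obtain ⟨φ, hφ, hn⟩ | ⟨c, φ, hφ, hn⟩ := exists_strictMono_comp_or_const n
  · exact (hno _ (m ∘ φ) y hn (h.comp hφ.tendsto_atTop)).elim
  · have h' : Tendsto (fun j => l c (m (φ j))) atTop (𝓝 y) := by
      simpa only [Function.comp_def, hn] using h.comp hφ.tendsto_atTop
    obtain ⟨ψ, hψ, hm⟩ | ⟨d, ψ, hψ, hm⟩ := exists_strictMono_comp_or_const (m ∘ φ)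
    · refine Or.inr ⟨c, ?_, φ ∘ ψ, hφ.comp hψ, hm, fun j => hn _⟩
      exact tendsto_nhds_unique (h'.comp hψ.tendsto_atTop) ((hl c).comp hm.tendsto_atTop)
    · refine Or.inl ⟨φ (ψ 0), tendsto_nhds_unique (h'.comp hψ.tendsto_atTop) ?_⟩
      have hm' : ∀ j, m (φ (ψ j)) = d := hm
      simp only [Function.comp_def, hm', hn]
      exact tendsto_const_nhds

namespace ArensSpace

theorem isOpen_iff {U : Set ArensSpace} : IsOpen U ↔
    (center ∈ U → ∀ᶠ n in atTop, mid n ∈ U) ∧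
      ∀ n, mid n ∈ U → ∀ᶠ m in atTop, leaf n m ∈ U := Iff.rfl

theorem center_mem_of_isClosed {F : Set ArensSpace} (hF : IsClosed F)
    (h : ∃ᶠ n in atTop, mid n ∈ F) : center ∈ F := by
  by_contra hc
  exact h ((isOpen_iff.1 hF.isOpen_compl).1 hc)

theorem mid_mem_of_isClosed {F : Set ArensSpace} (hF : IsClosed F) {n : ℕ}
    (h : ∃ᶠ m in atTop, leaf n m ∈ F) : mid n ∈ F := by
  by_contra hc
  exact h ((isOpen_iff.1 hF.isOpen_compl).2 n hc)

/-- The map of the Arens space given by the images of its points. -/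
def lift {X : Type*} (x : X) (a : ℕ → X) (l : ℕ → ℕ → X) : ArensSpace → X
  | center => x
  | mid n => a n
  | leaf n m => l n m

theorem continuous_lift {X : Type*} [TopologicalSpace X] {x : X} {a : ℕ → X} {l : ℕ → ℕ → X}
    (ha : Tendsto a atTop (𝓝 x)) (hl : ∀ n, Tendsto (l n) atTop (𝓝 (a n))) :
    Continuous (lift x a l) := by
  refine continuous_def.2 fun U hU => isOpen_iff.2 ⟨fun h => ?_, fun n h => ?_⟩
  · exact ha.eventually_mem (hU.mem_nhds h)
  · exact (hl n).eventually_mem (hU.mem_nhds h)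

/-- In a sequential space it suffices to follow convergent sequences in the image. A subsequence
stays at the center, on the mids, or on the leaves; in the last case `hno` confines it to one row.
-/
theorem isClosedMap_lift {X : Type*} [TopologicalSpace X] [T2Space X] [SequentialSpace X]
    {x : X} {a : ℕ → X} {l : ℕ → ℕ → X}
    (ha : Tendsto a atTop (𝓝 x)) (hl : ∀ n, Tendsto (l n) atTop (𝓝 (a n)))
    (hno : ∀ (φ m : ℕ → ℕ) (y : X), StrictMono φ →
      ¬ Tendsto (fun j => l (φ j) (m j)) atTop (𝓝 y)) :
    IsClosedMap (lift x a l) := by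
  intro F hF
  refine IsSeqClosed.isClosed fun t y ht hy => ?_
  choose q hqF hqt using ht
  by_cases hc : ∃ᶠ j in atTop, q j = center
  · obtain ⟨φ, hφ, hq⟩ := extraction_of_frequently_atTop hc
    refine ⟨center, hq 0 ▸ hqF _, tendsto_nhds_unique ?_ (hy.comp hφ.tendsto_atTop)⟩
    simp only [Function.comp_def, ← hqt, hq]
    exact tendsto_const_nhds
  by_cases hm : ∃ᶠ j in atTop, ∃ n, q j = mid n
  · obtain ⟨φ, hφ, hq⟩ := extraction_of_frequently_atTop hm
    choose n hn using hq
    have ht : ∀ j, t (φ j) = a (n j) := fun j => by rw [← hqt, hn]; rfl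
    have hy' : Tendsto (fun j => a (n j)) atTop (𝓝 y) := by
      simpa only [Function.comp_def, ht] using hy.comp hφ.tendsto_atTop
    have hmem : ∀ j, mid (n j) ∈ F := fun j => hn j ▸ hqF _
    obtain ⟨ψ, hψ, hnψ⟩ | ⟨c, ψ, hψ, hnψ⟩ := exists_strictMono_comp_or_const n
    · refine ⟨center, center_mem_of_isClosed hF ?_, tendsto_nhds_unique
        (ha.comp hnψ.tendsto_atTop) (hy'.comp hψ.tendsto_atTop)⟩
      exact hnψ.tendsto_atTop.frequently (Eventually.of_forall fun j => hmem (ψ j)).frequently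
    · refine ⟨mid c, hnψ 0 ▸ hmem _, tendsto_nhds_unique ?_ (hy'.comp hψ.tendsto_atTop)⟩
      simp only [Function.comp_def, hnψ]
      exact tendsto_const_nhds
  · have hleaf : ∃ᶠ j in atTop, ∃ n m, q j = leaf n m := by
      refine ((not_frequently.1 hc).and (not_frequently.1 hm)).frequently.mono fun j hj => ?_
      rcases hqj : q j with _ | n | ⟨n, m⟩
      · exact (hj.1 hqj).elim
      · exact (hj.2 ⟨n, hqj⟩).elim
      · exact ⟨n, m, rfl⟩
    obtain ⟨φ, hφ, hq⟩ := extraction_of_frequently_atTop hleaf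
    choose n m hn using hq
    have ht : ∀ j, t (φ j) = l (n j) (m j) := fun j => by rw [← hqt, hn]; rfl
    have hy' : Tendsto (fun j => l (n j) (m j)) atTop (𝓝 y) := by
      simpa only [Function.comp_def, ht] using hy.comp hφ.tendsto_atTop
    have hmem : ∀ j, leaf (n j) (m j) ∈ F := fun j => hn j ▸ hqF _
    obtain ⟨j, rfl⟩ | ⟨c, rfl, ψ, hψ, hmψ, hc⟩ := exists_eq_or_of_tendsto_double hl hno hy'
    · exact ⟨_, hmem j, rfl⟩
    · refine ⟨mid c, mid_mem_of_isClosed hF ?_, rfl⟩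
      refine hmψ.tendsto_atTop.frequently (Eventually.of_forall fun j => ?_).frequently
      rw [← hc j]
      exact hmem (ψ j)

end ArensSpace

variable {G : Type u} [Group G] [TopologicalSpace G] [IsTopologicalGroup G] [T1Space G]

theorem IsFan.hasClosedCopy_seqFan [SequentialSpace G] {s : ℕ → ℕ → G} (hs : IsFan s) :
    HasClosedCopy SeqFan G := by
  let g : ArensSpace → G := ArensSpace.lift 1 (fun _ => 1) s
  have hg : ∀ p q, ArensSpace.fanSetoid p q → g p = g q := by
    have h1 : ∀ p ∈ ArensSpace.baseSeq, g p = 1 := by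
      rintro p (rfl | ⟨n, rfl⟩) <;> rfl
    rintro p q (rfl | ⟨hp, hq⟩)
    · rfl
    · rw [h1 p hp, h1 q hq]
  have hcont : Continuous g := ArensSpace.continuous_lift tendsto_const_nhds hs.tendsto_one
  have hclosed : IsClosedMap g := ArensSpace.isClosedMap_lift tendsto_const_nhds hs.tendsto_one
    fun φ m y hφ => hs.not_tendsto m y hφ
  refine ⟨Quotient.lift g hg, .of_continuous_injective_isClosedMap (hcont.quotient_lift hg) ?_ ?_⟩
  · intro p q
    induction p, q using Quotient.inductionOn₂ with
    | h p q =>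
      intro h
      refine Quotient.sound ?_
      have h : g p = g q := h
      have hbase : ∀ n, ArensSpace.mid n ∈ ArensSpace.baseSeq := fun n => Or.inr ⟨n, rfl⟩
      have hcent : ArensSpace.center ∈ ArensSpace.baseSeq := Or.inl rfl
      rcases p with _ | n | ⟨n, m⟩ <;> rcases q with _ | n' | ⟨n', m'⟩
      · exact Or.inl rfl
      · exact Or.inr ⟨hcent, hbase _⟩
      · exact (hs.ne_one _ _ h.symm).elim
      · exact Or.inr ⟨hbase _, hcent⟩
      · exact Or.inr ⟨hbase _, hbase _⟩
      · exact (hs.ne_one _ _ h.symm).elim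
      · exact (hs.ne_one _ _ h).elim
      · exact (hs.ne_one _ _ h).elim
      · obtain ⟨rfl, rfl⟩ := hs.injective h
        exact Or.inl rfl
  · intro F hF
    convert hclosed _ (hF.preimage continuous_quotient_mk') using 1
    ext y
    constructor
    · rintro ⟨p, hp, rfl⟩
      induction p using Quotient.inductionOn with
      | h p => exact ⟨p, hp, rfl⟩
    · rintro ⟨p, hp, rfl⟩
      exact ⟨_, hp, rfl⟩

/-- The mids are row `0`, and the leaves at `a n` are `a n` times row `n + 1`. A convergent
selection of leaves, multiplied by the inverses of the `a n`, would be a convergent selection from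
the fan. -/
theorem IsFan.exists_isClosedEmbedding_arensSpace [SequentialSpace G] {s : ℕ → ℕ → G}
    (hs : IsFan s) : ∃ f : ArensSpace → G, IsClosedEmbedding f := by
  let a : ℕ → G := s 0
  have ha : Tendsto a atTop (𝓝 1) := hs.tendsto_one 0
  have hainj : ∀ {n k}, a n = a k → n = k := fun h => (hs.injective h).2
  have hrow : ∀ n, Tendsto (fun c => a n * s (n + 1) c) atTop (𝓝 (a n)) := fun n => by
    simpa using (hs.tendsto_one (n + 1)).const_mul (a n)
  have hne : ∀ n c, a n * s (n + 1) c ≠ a n := fun n c h => hs.ne_one _ _ (mul_eq_left.1 h)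
  let J : ℕ → Set ℕ := fun n => {c | a n * s (n + 1) c ≠ 1 ∧ ∀ k, a n * s (n + 1) c ≠ a k}
  have hJ : ∀ n, J n ∈ atTop := by
    intro n
    -- Replacing the value at `n` by `1` yields a compact set `{1} ∪ {a k | k ≠ n}` that misses `a
    -- n`.
    have hupd : Tendsto (Function.update a n 1) atTop (𝓝 1) := by
      refine ha.congr' ?_
      filter_upwards [eventually_gt_atTop n] with k hk
      rw [Function.update_of_ne hk.ne']
    have hcl := hupd.isCompact_insert_range.isClosed.isOpen_compl.mem_nhds (x := a n) (by
      rintro (h | ⟨k, hk⟩)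
      · exact hs.ne_one _ _ h
      · rcases eq_or_ne k n with rfl | hkn
        · rw [Function.update_self] at hk
          exact hs.ne_one _ _ hk.symm
        · rw [Function.update_of_ne hkn] at hk
          exact hkn (hainj hk))
    filter_upwards [(hrow n).eventually_mem hcl] with c hc
    refine ⟨fun h => hc (Or.inl h), fun k hk => ?_⟩
    rcases eq_or_ne k n with rfl | hkn
    · exact hne _ _ hk
    · exact hc (Or.inr ⟨k, by rw [Function.update_of_ne hkn, hk]⟩)
  obtain ⟨f, hf, hfA⟩ := exists_injective_selection
    (A := fun p => (fun c => a p.unpair.1 * s (p.unpair.1 + 1) c) ''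
      (J p.unpair.1 ∩ Ici p.unpair.2))
    (fun p => infinite_image_of_tendsto (hrow _) (hne _) (inter_mem (hJ _) (Ici_mem_atTop _)))
  have hc : ∀ n m, ∃ c ∈ J n ∩ Ici m, a n * s (n + 1) c = f (Nat.pair n m) := by
    intro n m
    simpa using hfA (Nat.pair n m)
  choose c hcJ hcf using hc
  let l : ℕ → ℕ → G := fun n m => a n * s (n + 1) (c n m)
  have hl : ∀ n, Tendsto (l n) atTop (𝓝 (a n)) := fun n =>
    (hrow n).comp (tendsto_atTop_mono (fun m => (hcJ n m).2) tendsto_id)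
  refine ⟨ArensSpace.lift 1 a l, .of_continuous_injective_isClosedMap
    (ArensSpace.continuous_lift ha hl) ?_ (ArensSpace.isClosedMap_lift ha hl ?_)⟩
  · intro p q h
    rcases p with _ | n | ⟨n, m⟩ <;> rcases q with _ | n' | ⟨n', m'⟩
    · rfl
    · exact (hs.ne_one _ _ h.symm).elim
    · exact ((hcJ _ _).1.1 h.symm).elim
    · exact (hs.ne_one _ _ h).elim
    · rw [hainj h]
    · exact ((hcJ _ _).1.2 _ h.symm).elim
    · exact ((hcJ _ _).1.1 h).elim
    · exact ((hcJ _ _).1.2 _ h).elim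
    · have h : l n m = l n' m' := h
      simp only [l, hcf] at h
      obtain ⟨rfl, rfl⟩ := Nat.pair_eq_pair.1 (hf h)
      rfl
  · intro φ m y hφ hy
    refine hs.not_tendsto (φ := fun j => φ j + 1) (fun j => c (φ j) (m j)) y
      (fun i j hij => Nat.succ_lt_succ (hφ hij)) ?_
    simpa [l] using (ha.comp hφ.tendsto_atTop).inv.mul hy

/-- The center is in the closure of the leaves, but no sequence of leaves tends to it: one leaf per
row is a closed set, and a single row stays away from the center. -/
theorem not_frechetUrysohnSpace_arensSpace : ¬ FrechetUrysohnSpace ArensSpace := by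
  intro h
  have hcl : ArensSpace.center ∈ closure (range fun p : ℕ × ℕ => ArensSpace.leaf p.1 p.2) := by
    refine ArensSpace.center_mem_of_isClosed isClosed_closure
      (Eventually.of_forall fun n => ?_).frequently
    refine ArensSpace.mid_mem_of_isClosed isClosed_closure
      (Eventually.of_forall fun m => ?_).frequently
    exact subset_closure ⟨(n, m), rfl⟩
  obtain ⟨t, ht, htc⟩ := h.closure_subset_seqClosure _ hcl
  choose p hp using ht
  obtain rfl : (fun j => ArensSpace.leaf (p j).1 (p j).2) = t := funext hp
  obtain ⟨φ, hφ, hn⟩ | ⟨c, φ, hφ, hn⟩ := exists_strictMono_comp_or_const fun j => (p j).1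
  · have hU : IsOpen (range fun j => ArensSpace.leaf (p (φ j)).1 (p (φ j)).2)ᶜ := by
      refine ArensSpace.isOpen_iff.2 ⟨fun _ => Eventually.of_forall fun n => by simp, fun n _ => ?_⟩
      have hfin : {m | ArensSpace.leaf n m ∈
          range fun j => ArensSpace.leaf (p (φ j)).1 (p (φ j)).2}.Subsingleton := by
        rintro m ⟨i, hi⟩ m' ⟨j, hj⟩
        simp only [ArensSpace.leaf.injEq] at hi hj
        obtain rfl : i = j := hn.injective (hi.1.trans hj.1.symm)
        exact hi.2.symm.trans hj.2
      have := hfin.finite.compl_mem_cofinite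
      rwa [Nat.cofinite_eq_atTop] at this
    obtain ⟨j, hj⟩ := ((htc.comp hφ.tendsto_atTop).eventually_mem
      (hU.mem_nhds (by simp))).exists
    exact hj ⟨j, rfl⟩
  · have hU : IsOpen {q : ArensSpace | ∀ m, q ≠ ArensSpace.leaf c m ∧ q ≠ ArensSpace.mid c} := by
      refine ArensSpace.isOpen_iff.2 ⟨fun _ => ?_, fun n hn => Eventually.of_forall fun m k => ?_⟩
      · filter_upwards [eventually_gt_atTop c] with n hn k
        simpa using hn.ne'
      · simpa using fun h : n = c => ((hn k).2 (by rw [h])).elim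
    obtain ⟨j, hj⟩ := ((htc.comp hφ.tendsto_atTop).eventually_mem
      (hU.mem_nhds (by simp))).exists
    refine (hj (p (φ j)).2).1 ?_
    simp only [Function.comp_def]
    rw [← hn j]

theorem IsFan.not_frechetUrysohnSpace {s : ℕ → ℕ → G} (hs : IsFan s) :
    ¬ FrechetUrysohnSpace G := by
  intro h
  obtain ⟨f, hf⟩ := hs.exists_isClosedEmbedding_arensSpace
  exact not_frechetUrysohnSpace_arensSpace hf.isInducing.frechetUrysohnSpace

omit [IsTopologicalGroup G] [T1Space G] in
theorem IsFan.not_isAlphaSeven {s : ℕ → ℕ → G} (hs : IsFan s) : ¬ IsAlphaSeven G := by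
  intro h
  obtain ⟨T, y, hT, hinf⟩ := h 1 (fun n => range (s n)) fun n => by
    refine ⟨countable_range _, infinite_range_of_injective fun i j hij => (hs.injective hij).2,
      fun U hU => ?_⟩
    have hfin := (hs.tendsto_one n).eventually_mem hU
    rw [← Nat.cofinite_eq_atTop, eventually_cofinite] at hfin
    refine (hfin.image (s n)).subset ?_
    rintro _ ⟨⟨m, rfl⟩, hm⟩
    exact ⟨m, hm, rfl⟩
  obtain ⟨φ, hφ, hφT⟩ := extraction_of_frequently_atTop (Nat.frequently_atTop_iff_infinite.2 hinf)
  have : ∀ j, ∃ m, s (φ j) m ∈ T := by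
    intro j
    obtain ⟨_, ⟨m, rfl⟩, hm⟩ := hφT j
    exact ⟨m, hm⟩
  choose m hm using this
  refine hs.not_tendsto m y hφ fun U hU => ?_
  rw [mem_map, ← Nat.cofinite_eq_atTop, mem_cofinite]
  refine ((hT.2.2 U hU).preimage (f := fun j => s (φ j) (m j)) ?_).subset
    fun j hj => ⟨hm j, hj⟩
  exact fun i _ j _ hij => hφ.injective (hs.injective hij).1

/-- A barrier contains each row from some column on, which gives a function `f`. For any `g` the
part of the fan on or below the graph of `g` is closed and misses `1`, so a barrier avoiding it has
`f` above `g`: the functions `f` are cofinal. -/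
theorem IsFan.dominatingNumber_le_sbCharacter [SequentialSpace G] {s : ℕ → ℕ → G} (hs : IsFan s) :
    Cardinal.lift.{u} dominatingNumber ≤ sbCharacter G := by
  have hle : sbCharacterAt (1 : G) ≤ sbCharacter G :=
    (le_ciSup (f := fun x : G => sbCharacterAt x) Cardinal.bddAbove_of_small 1).trans
      (le_max_right _ _)
  refine le_trans ?_ hle
  have hne : {κ | ∃ 𝒩 : Set (Set G), IsSbNetworkAt 𝒩 (1 : G) ∧ #𝒩 = κ}.Nonempty :=
    ⟨_, {U | U ∈ 𝓝 (1 : G)}, ⟨fun U hU a ha => ha.eventually_mem hU,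
      fun U hU => ⟨U, hU, mem_of_mem_nhds hU, Subset.rfl⟩⟩, rfl⟩
  obtain ⟨𝒩, h𝒩, hc⟩ := csInf_mem hne
  rw [sbCharacterAt, ← hc]
  have hf : ∀ B : 𝒩, ∃ f : ℕ → ℕ, ∀ k m, f k ≤ m → s k m ∈ B.1 := by
    intro B
    have : ∀ k, ∃ c, ∀ m, c ≤ m → s k m ∈ B.1 := fun k =>
      eventually_atTop.1 (h𝒩.1 B.1 B.2 _ (hs.tendsto_one k))
    choose f hf using this
    exact ⟨f, hf⟩
  choose f hf using hf
  have hcof : IsCofinal (range f) := by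
    intro g
    have hclosed : IsClosed {x | ∃ k m, m ≤ g k ∧ x = s k m} := by
      refine IsSeqClosed.isClosed fun t y ht hy => ?_
      choose n m hm ht using ht
      obtain rfl : t = fun j => s (n j) (m j) := funext ht
      obtain ⟨j, rfl⟩ | ⟨c, rfl, φ, hφ, hmφ, hn⟩ := exists_eq_or_of_tendsto_double
        (a := fun _ => 1) hs.tendsto_one (fun φ m y hφ => hs.not_tendsto m y hφ) hy
      · exact ⟨_, _, hm j, rfl⟩
      · have h1 := hmφ.le_apply (x := g c + 1)
        have h2 := hm (φ (g c + 1))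
        rw [hn] at h2
        have h3 := h1.trans h2
        omega
    obtain ⟨B, hB, -, hBU⟩ := h𝒩.2 _ (hclosed.isOpen_compl.mem_nhds (x := 1) (by
      rintro ⟨k, m, -, h⟩
      exact hs.ne_one k m h.symm))
    refine ⟨f ⟨B, hB⟩, mem_range_self _, fun k => ?_⟩
    by_contra! hlt
    exact hBU (hf ⟨B, hB⟩ k (g k) hlt.le) ⟨k, g k, le_rfl, rfl⟩
  have h1 := Cardinal.lift_le.{u}.2 (Order.cof_le hcof)
  refine h1.trans ?_
  simpa using Cardinal.mk_range_le_lift (f := f)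

end Copies

/-! ### Exhausting an open subgroup by compact metrizable sets -/

section Exhaustion

variable {G : Type u} [Group G] [TopologicalSpace G]

theorem IsFan.not_isSeqCompact {s : ℕ → ℕ → G} (hs : IsFan s) {L : Set G}
    (hL : ∀ k m, s k m ∈ L) : ¬ IsSeqCompact L := by
  intro h
  obtain ⟨y, -, φ, hφ, hy⟩ := h fun k => hL k 0
  exact hs.not_tendsto (fun _ => 0) y hφ hy

theorem isSeqCompact_empty {X : Type*} [TopologicalSpace X] : IsSeqCompact (∅ : Set X) :=
  fun _ h => (h 0).elim

theorem isSeqCompact_singleton {X : Type*} [TopologicalSpace X] (x : X) :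
    IsSeqCompact ({x} : Set X) := fun a ha =>
  ⟨x, rfl, id, strictMono_id, by
    rw [show a = fun _ => x from funext ha]
    exact tendsto_const_nhds⟩

theorem isSeqCompact_union {X : Type*} [TopologicalSpace X] {K L : Set X} (hK : IsSeqCompact K)
    (hL : IsSeqCompact L) : IsSeqCompact (K ∪ L) := by
  intro a ha
  by_cases h : ∃ᶠ n in atTop, a n ∈ K
  · obtain ⟨x, hx, φ, hφ, hlim⟩ := hK.subseq_of_frequently_in h
    exact ⟨x, Or.inl hx, φ, hφ, hlim⟩
  · obtain ⟨x, hx, φ, hφ, hlim⟩ := hL.subseq_of_frequently_in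
      ((not_frequently.1 h).mono fun n hn => (ha n).resolve_left hn).frequently
    exact ⟨x, Or.inr hx, φ, hφ, hlim⟩

theorem isClosed_of_isSeqCompact {X : Type*} [TopologicalSpace X] [T2Space X] [SequentialSpace X]
    {K : Set X} (hK : IsSeqCompact K) : IsClosed K := by
  refine IsSeqClosed.isClosed fun a x ha hx => ?_
  obtain ⟨y, hy, φ, hφ, hlim⟩ := hK ha
  exact tendsto_nhds_unique (hx.comp hφ.tendsto_atTop) hlim ▸ hy

variable [IsTopologicalGroup G]

theorem isSeqCompact_mul {K L : Set G} (hK : IsSeqCompact K) (hL : IsSeqCompact L) :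
    IsSeqCompact (K * L) := by
  intro a ha
  choose b hb c hc h using fun n => mem_mul.1 (ha n)
  obtain ⟨x, hx, φ, hφ, hlim⟩ := hK hb
  obtain ⟨y, hy, ψ, hψ, hlim'⟩ := hL fun n => hc (φ n)
  refine ⟨x * y, mul_mem_mul hx hy, φ ∘ ψ, hφ.comp hψ, ?_⟩
  simpa only [Function.comp_def, h] using (hlim.comp hψ.tendsto_atTop).mul hlim'

theorem isSeqCompact_inv {K : Set G} (hK : IsSeqCompact K) : IsSeqCompact K⁻¹ := by
  intro a ha
  obtain ⟨x, hx, φ, hφ, hlim⟩ := hK ha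
  exact ⟨x⁻¹, by simpa using hx, φ, hφ, by simpa [Function.comp_def] using hlim.inv⟩

variable [SequentialSpace G]

omit [SequentialSpace G] in
-- Finite unions of closures upgrade "infinitely many" to "almost all": if no such union inside a
-- closed `V ⊆ U` worked, a subsequence avoiding ever more of the `N i ⊆ V` would contradict the
-- `cs*` property.
theorem exists_isClosed_csNetwork {N : ℕ → Set G} (hN : IsCsStarSeq N) :
    ∃ Q : ℕ → Set G, (∀ i, IsClosed (Q i)) ∧ ∀ U ∈ 𝓝 (1 : G), ∀ a : ℕ → G,
      Tendsto a atTop (𝓝 1) → ∃ i, Q i ⊆ U ∧ ∀ᶠ n in atTop, a n ∈ Q i := by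
  classical
  obtain ⟨e, he⟩ := exists_surjective_nat (Finset ℕ)
  refine ⟨fun n => ⋃ i ∈ e n, closure (N i),
    fun n => (e n).finite_toSet.isClosed_biUnion fun i _ => isClosed_closure, fun U hU a ha => ?_⟩
  obtain ⟨V, ⟨hV, hVc⟩, hVU⟩ := (closed_nhds_basis (1 : G)).mem_iff.1 hU
  by_contra! hc
  have hI : ∀ k : ℕ, ∃ᶠ n in atTop,
      a n ∉ ⋃ i ∈ (Finset.range k).filter (fun i => N i ⊆ V), closure (N i) := by
    intro k
    obtain ⟨n, hn⟩ := he ((Finset.range k).filter fun i => N i ⊆ V)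
    rw [← hn]
    refine hc n ?_
    rw [hn]
    exact iUnion₂_subset fun i hi =>
      (closure_minimal (Finset.mem_filter.1 hi).2 hVc).trans hVU
  obtain ⟨φ, hφ, hφa⟩ := extraction_forall_of_frequently hI
  obtain ⟨i, hiV, hfr⟩ := hN V hV _ (ha.comp hφ.tendsto_atTop)
  obtain ⟨k, hk, hik⟩ := (hfr.and_eventually (eventually_gt_atTop i)).exists
  refine hφa k (mem_biUnion (x := i) ?_ (subset_closure hk))
  simpa using ⟨hik, hiV⟩

variable [T1Space G]

/-- In the presence of a fan, there is no uniformly converging sequence of sequences without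
convergent subsequences. -/
theorem IsFan.exists_subseq_tendsto {s : ℕ → ℕ → G} (hs : IsFan s) {p : ℕ → ℕ → G}
    (hp : ∀ U ∈ 𝓝 (1 : G), ∀ᶠ n in atTop, ∀ m, p n m ∈ U) :
    ∃ (n : ℕ) (φ : ℕ → ℕ) (y : G), StrictMono φ ∧ Tendsto (fun j => p n (φ j)) atTop (𝓝 y) := by
  by_contra! hno
  -- A convergent sequence here cannot use infinitely many rows, since removing the factors `p`,
  -- which tend to `1`, would leave a convergent fan selection. Nor can it use infinitely many
  -- columns of one row, by `hno`.
  have hclosed : IsClosed {z | z ≠ 1 ∧ ∃ n m, z = p n m * s n m} := by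
    refine IsSeqClosed.isClosed fun t y ht hy => ?_
    choose ht1 n m ht using ht
    obtain rfl : t = fun j => p (n j) (m j) * s (n j) (m j) := funext ht
    obtain ⟨φ, hφ, hn⟩ | ⟨c, φ, hφ, hn⟩ := exists_strictMono_comp_or_const n
    · have h1 : Tendsto (fun j => p (n (φ j)) (m (φ j))) atTop (𝓝 1) := fun U hU =>
        (hn.tendsto_atTop.eventually (hp U hU)).mono fun j hj => hj _
      refine (hs.not_tendsto (m ∘ φ) y hn ?_).elim
      simpa [Function.comp_def] using h1.inv.mul (hy.comp hφ.tendsto_atTop)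
    · have hy' := hy.comp hφ.tendsto_atTop
      simp only [Function.comp_def, hn] at hy'
      obtain ⟨ψ, hψ, hm⟩ | ⟨d, ψ, hψ, hm⟩ := exists_strictMono_comp_or_const (m ∘ φ)
      · refine (hno c (m ∘ φ ∘ ψ) y hm ?_).elim
        have h1 : Tendsto (fun j => s c (m (φ (ψ j)))) atTop (𝓝 1) :=
          (hs.tendsto_one c).comp hm.tendsto_atTop
        simpa [Function.comp_def] using (hy'.comp hψ.tendsto_atTop).mul h1.inv
      · have hm' : ∀ j, m (φ (ψ j)) = d := hm
        have hy'' := hy'.comp hψ.tendsto_atTop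
        simp only [Function.comp_def, hm'] at hy''
        have := tendsto_nhds_unique hy'' tendsto_const_nhds
        subst this
        refine ⟨?_, c, d, rfl⟩
        have := ht1 (φ (ψ 0))
        simpa only [hn, hm'] using this
  have h1 : {z | z ≠ 1 ∧ ∃ n m, z = p n m * s n m}ᶜ ∈ 𝓝 (1 : G) :=
    hclosed.isOpen_compl.mem_nhds (by simp)
  obtain ⟨W, hW, hWW⟩ := exists_nhds_one_split h1
  obtain ⟨n, hn⟩ := (hp W hW).exists
  -- Products of two elements of `W` avoid the closed set, so they can only equal `1`; then `p n`
  -- itself converges.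
  have heq : ∀ᶠ m in atTop, (s n m)⁻¹ = p n m := by
    filter_upwards [(hs.tendsto_one n).eventually_mem hW] with m hm
    by_contra hne
    exact hWW _ (hn m) _ hm ⟨fun h => hne (eq_inv_of_mul_eq_one_left h).symm, n, m, rfl⟩
  refine hno n id 1 strictMono_id (Tendsto.congr' heq ?_)
  simpa using (hs.tendsto_one n).inv

/-- For `a` tending to `1`, the intersections of the first sets `Q i` that almost contain `a` shrink
into every neighbourhood of `1`. Were none sequentially compact, divergent sequences in them would
contradict `IsFan.exists_subseq_tendsto`. -/
theorem IsFan.exists_isSeqCompact_family {s : ℕ → ℕ → G} (hs : IsFan s) {N : ℕ → Set G}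
    (hN : IsCsStarSeq N) : ∃ C : ℕ → Set G, (∀ i, IsSeqCompact (C i)) ∧
      ∀ a : ℕ → G, Tendsto a atTop (𝓝 1) → ∃ i, ∀ᶠ n in atTop, a n ∈ C i := by
  classical
  obtain ⟨Q, hQ, hQN⟩ := exists_isClosed_csNetwork hN
  obtain ⟨e, he⟩ := exists_surjective_nat (Finset ℕ)
  refine ⟨fun n => if IsSeqCompact (⋂ i ∈ e n, Q i) then ⋂ i ∈ e n, Q i else ∅,
    fun n => ?_, fun a ha => ?_⟩
  · dsimp only
    split_ifs with h
    · exact h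
    · exact isSeqCompact_empty
  let I : ℕ → Finset ℕ := fun k =>
    (Finset.range k).filter fun i => ∀ᶠ n in atTop, a n ∈ Q i
  have haI : ∀ k, ∀ᶠ n in atTop, a n ∈ ⋂ i ∈ I k, Q i := by
    intro k
    simp only [mem_iInter]
    exact (Finset.eventually_all _).2 fun i hi => (Finset.mem_filter.1 hi).2
  obtain ⟨k, hk⟩ : ∃ k, IsSeqCompact (⋂ i ∈ I k, Q i) := by
    by_contra! hc
    have hclosed : ∀ k, IsClosed (⋂ i ∈ I k, Q i) := fun k =>
      isClosed_biInter fun i _ => hQ i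
    have : ∀ k, ∃ p : ℕ → G, (∀ m, p m ∈ ⋂ i ∈ I k, Q i) ∧ ∀ (φ : ℕ → ℕ) (y : G), StrictMono φ →
        ¬ Tendsto (fun j => p (φ j)) atTop (𝓝 y) := by
      intro k
      have h := hc k
      unfold IsSeqCompact at h
      push Not at h
      obtain ⟨p, hp, h⟩ := h
      exact ⟨p, hp, fun φ y hφ hy =>
        h y ((hclosed k).isSeqClosed (fun j => hp (φ j)) hy) φ hφ hy⟩
    choose p hp hno using this
    obtain ⟨n, φ, y, hφ, hy⟩ := hs.exists_subseq_tendsto (p := p) fun U hU => by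
      obtain ⟨i, hiU, hi⟩ := hQN U hU a ha
      filter_upwards [eventually_gt_atTop i] with k hk m
      exact hiU (mem_iInter₂.1 (hp k m) i (Finset.mem_filter.2 ⟨Finset.mem_range.2 hk, hi⟩))
    exact hno n φ y hφ hy
  obtain ⟨n, hn⟩ := he (I k)
  refine ⟨n, ?_⟩
  simp only [hn, if_pos hk]
  exact haI k

/-- In a sequential group with countable `cs*`-character, sequentially compact sets are compact
and metrizable. -/
theorem compactSpace_metrizableSpace_of_isSeqCompact {N : ℕ → Set G}
    (hN : IsCsStarSeq N) {K : Set G} (hK : IsSeqCompact K) :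
    CompactSpace K ∧ TopologicalSpace.MetrizableSpace K := by
  rcases K.eq_empty_or_nonempty with rfl | ⟨x₀, hx₀⟩
  · exact ⟨inferInstance, inferInstance⟩
  set L : Set G := K⁻¹ * K with hLdef
  have hL : IsSeqCompact L := isSeqCompact_mul (isSeqCompact_inv hK) hK
  have h1L : (1 : G) ∈ L := ⟨x₀⁻¹, by simpa using hx₀, x₀, hx₀, by simp⟩
  -- The set `L⁻¹ * L` is sequentially compact, so it contains no fan. The barriers then give a
  -- countable base of `L` at `1`, hence of the left uniformity on `K`.
  obtain ⟨B, hB⟩ | ⟨s, hs, hsL⟩ := exists_barrierNetwork_or_isFan hN (L⁻¹ * L)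
  swap
  · exact (hs.not_isSeqCompact hsL (isSeqCompact_mul (isSeqCompact_inv hL) hL)).elim
  have hBL : ∀ n, B n ∈ 𝓝[L] (1 : G) := fun n => by
    simpa using hB.eventually_nhdsWithin (isClosed_of_isSeqCompact hL)
      (fun x hx y hy => mul_mem_mul (by simpa using hx) hy) h1L n
  have hcg : IsCountablyGenerated (𝓝[L] (1 : G)) := by
    refine isCountablyGenerated_of_forall_exists_subset (B := fun n => B n ∩ L)
      (fun n => inter_mem (hBL n) self_mem_nhdsWithin) fun U hU => ?_
    obtain ⟨V, hV, hVU⟩ := mem_nhdsWithin_iff_exists_mem_nhds_inter.1 hU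
    obtain ⟨n, hn⟩ := hB.2 V hV
    exact ⟨n, (inter_subset_inter_left L hn).trans hVU⟩
  let _ : UniformSpace G := IsTopologicalGroup.leftUniformSpace G
  have hunif : IsCountablyGenerated (uniformity K) := by
    have : uniformity K = comap (fun p : K × K => (p.1 : G)⁻¹ * p.2) (𝓝[L] 1) := by
      rw [uniformity_subtype, nhdsWithin, comap_inf, comap_principal]
      have huniv : (fun p : K × K => (p.1 : G)⁻¹ * p.2) ⁻¹' L = univ :=
        eq_univ_of_forall fun p => mul_mem_mul (by simp) p.2.2
      rw [huniv, principal_univ, inf_top_eq]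
      exact comap_comap
    rw [this]
    infer_instance
  have hcomp : IsCompact (univ : Set K) := by
    refine IsSeqCompact.isCompact fun a _ => ?_
    obtain ⟨x, hx, φ, hφ, hlim⟩ := hK fun n => (a n).2
    exact ⟨⟨x, hx⟩, mem_univ _, φ, hφ, tendsto_subtype_rng.2 hlim⟩
  exact ⟨⟨hcomp⟩, UniformSpace.metrizableSpace⟩

/-- An exhaustion of an open subgroup by compact metrizable sets that determine the topology. -/
structure IsExhaustion (K : ℕ → Set G) : Prop where
  monotone : Monotone K
  isSeqCompact : ∀ n, IsSeqCompact (K n)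
  isCompact : ∀ n, IsCompact (K n)
  metrizableSpace : ∀ n, TopologicalSpace.MetrizableSpace (K n)
  one_mem : ∀ n, 1 ∈ K n
  mul_mem : ∀ n, ∀ x ∈ K n, ∀ y ∈ K n, x * y ∈ K (n + 1)
  inv_mem : ∀ n, ∀ x ∈ K n, x⁻¹ ∈ K n
  eventually_mem : ∀ a : ℕ → G, Tendsto a atTop (𝓝 1) → ∃ n, ∀ᶠ j in atTop, a j ∈ K n

theorem IsFan.exists_isExhaustion {s : ℕ → ℕ → G} (hs : IsFan s) {N : ℕ → Set G}
    (hN : IsCsStarSeq N) : ∃ K : ℕ → Set G, IsExhaustion K := by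
  obtain ⟨C, hC, hCa⟩ := hs.exists_isSeqCompact_family hN
  let D : ℕ → Set G → Set G := fun n A => A ∪ (C n ∪ (C n)⁻¹)
  -- Squaring makes products land one level up; adjoining `C n` and its inverse captures every
  -- sequence tending to `1`.
  let K : ℕ → Set G := fun n => Nat.rec {1} (fun n A => D n A * D n A) n
  have hK : ∀ n, K (n + 1) = D n (K n) * D n (K n) := fun _ => rfl
  have h1 : ∀ n, (1 : G) ∈ K n := by
    intro n
    induction n with
    | zero => exact rfl
    | succ n ih => exact ⟨1, Or.inl ih, 1, Or.inl ih, mul_one 1⟩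
  have hDK : ∀ n, D n (K n) ⊆ K (n + 1) := fun n x hx => ⟨x, hx, 1, Or.inl (h1 n), mul_one x⟩
  have hmono : Monotone K := monotone_nat_of_le_succ fun n => subset_union_left.trans (hDK n)
  have hsc : ∀ n, IsSeqCompact (K n) := by
    intro n
    induction n with
    | zero => exact isSeqCompact_singleton 1
    | succ n ih =>
      have hD := isSeqCompact_union ih (isSeqCompact_union (hC n) (isSeqCompact_inv (hC n)))
      exact isSeqCompact_mul hD hD
  have hinv : ∀ n, ∀ x ∈ K n, x⁻¹ ∈ K n := by
    intro n
    induction n with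
    | zero =>
      rintro x rfl
      exact inv_one
    | succ n ih =>
      have hD : ∀ x ∈ D n (K n), x⁻¹ ∈ D n (K n) := by
        rintro x (hx | hx | hx)
        · exact Or.inl (ih x hx)
        · exact Or.inr (Or.inr (by simpa using hx))
        · exact Or.inr (Or.inl hx)
      rintro _ ⟨x, hx, y, hy, rfl⟩
      exact ⟨y⁻¹, hD y hy, x⁻¹, hD x hx, (mul_inv_rev x y).symm⟩
  have hcm := fun n => compactSpace_metrizableSpace_of_isSeqCompact hN (hsc n)
  refine ⟨K, hmono, hsc, fun n => isCompact_iff_compactSpace.2 (hcm n).1, fun n => (hcm n).2,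
    h1, fun n x hx y hy => ⟨x, Or.inl hx, y, Or.inl hy, rfl⟩, hinv, fun a ha => ?_⟩
  obtain ⟨i, hi⟩ := hCa a ha
  exact ⟨i + 1, hi.mono fun j hj => hDK i (Or.inr (Or.inl hj))⟩

namespace IsExhaustion

variable {K : ℕ → Set G} (hK : IsExhaustion K)
include hK

theorem isClosed (n : ℕ) : IsClosed (K n) := isClosed_of_isSeqCompact (hK.isSeqCompact n)

omit [SequentialSpace G] [T1Space G] in
theorem eventually_mem_of_tendsto {n : ℕ} {x : G} (hx : x ∈ K n) {a : ℕ → G}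
    (ha : Tendsto a atTop (𝓝 x)) : ∃ m, ∀ᶠ j in atTop, a j ∈ K m := by
  obtain ⟨p, hp⟩ := hK.eventually_mem (fun j => x⁻¹ * a j) (by simpa using ha.const_mul x⁻¹)
  refine ⟨max n p + 1, hp.mono fun j hj => ?_⟩
  have := hK.mul_mem (max n p) x (hK.monotone (le_max_left _ _) hx) _
    (hK.monotone (le_max_right _ _) hj)
  simpa using this

omit [T1Space G] in
theorem isOpen_iUnion : IsOpen (⋃ n, K n) := by
  refine isOpen_of_forall_tendsto fun x hx a ha => ?_
  obtain ⟨n, hn⟩ := mem_iUnion.1 hx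
  obtain ⟨m, hm⟩ := hK.eventually_mem_of_tendsto hn ha
  exact hm.mono fun j hj => mem_iUnion.2 ⟨m, hj⟩

omit [IsTopologicalGroup G] [SequentialSpace G] [T1Space G] in
theorem inv_mul_mem {x y : G} (hx : x ∈ ⋃ n, K n) (hy : y ∈ ⋃ n, K n) :
    x⁻¹ * y ∈ ⋃ n, K n := by
  obtain ⟨n, hn⟩ := mem_iUnion.1 hx
  obtain ⟨m, hm⟩ := mem_iUnion.1 hy
  exact mem_iUnion.2 ⟨_, hK.mul_mem (max n m) _ (hK.inv_mem _ _ (hK.monotone (le_max_left _ _) hn))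
    _ (hK.monotone (le_max_right _ _) hm)⟩

omit [T1Space G] in
theorem isClosed_iUnion : IsClosed (⋃ n, K n) := by
  let H : Subgroup G := Subgroup.ofDiv (⋃ n, K n) ⟨1, mem_iUnion.2 ⟨0, hK.one_mem 0⟩⟩ (by
    intro x hx y hy
    have h1 : (1 : G) ∈ ⋃ n, K n := mem_iUnion.2 ⟨0, hK.one_mem 0⟩
    have hx' := hK.inv_mul_mem hx h1
    have hy' := hK.inv_mul_mem hy h1
    simpa using hK.inv_mul_mem hx' hy')
  exact H.isClosed_of_isOpen hK.isOpen_iUnion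

end IsExhaustion

end Exhaustion

/-! ### Baire property, `k`-ness, cardinality and Weil completeness -/

section Consequences

variable {G : Type u} [Group G] [TopologicalSpace G]

theorem exists_cover_of_boundednessIndex {U : Set G} (hU : IsOpen U) (hne : U.Nonempty) :
    ∃ F : Set G, #F ≤ boundednessIndex G ∧ (univ : Set G) = Set.image2 (fun x y => x * y) F U := by
  refine csInf_mem (s := {κ | ∀ U : Set G, IsOpen U → U.Nonempty →
    ∃ F : Set G, #F ≤ κ ∧ (univ : Set G) = Set.image2 (fun x y => x * y) F U})
    ⟨#G, ?_⟩ U hU hne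
  rintro U - ⟨u, hu⟩
  refine ⟨univ, Cardinal.mk_univ.le, ?_⟩
  refine Eq.symm (eq_univ_of_forall fun g => ?_)
  exact ⟨g * u⁻¹, mem_univ _, u, hu, by simp⟩

variable [IsTopologicalGroup G] [T1Space G]

/-- For `n + 1` points there is a neighbourhood so small that each of its left translates contains
at most one of them, so `n` translates cannot cover. -/
theorem aleph0_le_boundednessIndex [Infinite G] : ℵ₀ ≤ boundednessIndex G := by
  by_contra! hlt
  obtain ⟨n, hn⟩ := Cardinal.lt_aleph0.1 hlt
  obtain ⟨t, ht⟩ := Infinite.exists_subset_card_eq G (n + 1)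
  have hfin : {z : G | z ≠ 1 ∧ z ∈ (t : Set G)⁻¹ * (t : Set G)}.Finite :=
    ((t.finite_toSet.inv).mul t.finite_toSet).subset fun z hz => hz.2
  have hnhds := hfin.isClosed.isOpen_compl.mem_nhds (x := (1 : G)) (by simp)
  obtain ⟨V, hV, hVV⟩ := exists_nhds_split_inv hnhds
  have hV' : V⁻¹ ∈ 𝓝 (1 : G) := inv_mem_nhds_one G hV
  obtain ⟨W, hWV, hWo, hW1⟩ := mem_nhds_iff.1 hV'
  obtain ⟨F, hF, hFW⟩ := exists_cover_of_boundednessIndex hWo ⟨1, hW1⟩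
  have hex : ∀ g : G, ∃ f ∈ F, f⁻¹ * g ∈ W := by
    intro g
    obtain ⟨f, hf, w, hw, rfl⟩ : g ∈ Set.image2 (fun x y => x * y) F W := hFW ▸ mem_univ g
    exact ⟨f, hf, by simpa using hw⟩
  choose f hfF hfW using hex
  have hinj : Function.Injective fun g : t => (⟨f g, hfF g⟩ : F) := by
    intro g g' h
    by_contra hne
    have hfe : f (g : G) = f g' := congrArg Subtype.val h
    have h1 := hWV (hfW g)
    have h2 := hWV (hfW g')
    rw [← hfe] at h2
    refine hVV _ h1 _ h2 ⟨fun h => hne ?_, ?_⟩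
    · refine Subtype.ext (inv_mul_eq_one.1 ?_)
      simpa using h
    · exact ⟨(g : G)⁻¹, by simp, g', g'.2, by simp [div_eq_mul_inv]⟩
  have hcard := Cardinal.mk_le_of_injective hinj
  rw [Cardinal.mk_coe_finset, ht] at hcard
  have := hcard.trans (hF.trans_eq hn)
  norm_cast at this
  omega

variable [SequentialSpace G]

namespace IsExhaustion

variable {K : ℕ → Set G} (hK : IsExhaustion K)
include hK

/-- Some `K n` has an interior point, at which `G` is first countable because `K n` is metrizable;
translation moves this to `1`. -/
theorem metrizableSpace_of_baireSpace [BaireSpace G] : TopologicalSpace.MetrizableSpace G := by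
  have hdense := dense_iUnion_interior_of_closed (f := fun n => K n ∪ (⋃ n, K n)ᶜ)
    (fun n => (hK.isClosed n).union hK.isOpen_iUnion.isClosed_compl) (by
      refine eq_univ_of_forall fun x => ?_
      by_cases hx : x ∈ ⋃ n, K n
      · obtain ⟨n, hn⟩ := mem_iUnion.1 hx
        exact mem_iUnion.2 ⟨n, Or.inl hn⟩
      · exact mem_iUnion.2 ⟨0, Or.inr hx⟩)
  obtain ⟨x, hxK, hx⟩ := hdense.inter_open_nonempty _ hK.isOpen_iUnion
    ⟨1, mem_iUnion.2 ⟨0, hK.one_mem 0⟩⟩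
  obtain ⟨n, hn⟩ := mem_iUnion.1 hx
  have hmem : K n ∈ 𝓝 x := by
    filter_upwards [isOpen_interior.mem_nhds hn, hK.isOpen_iUnion.mem_nhds hxK] with y hy hyK
    exact (interior_subset hy).resolve_right fun h => h hyK
  have := hK.metrizableSpace n
  have hx' : IsCountablyGenerated (𝓝 x) := by
    have := map_nhds_subtype_coe_eq_nhds (mem_of_mem_nhds hmem) hmem
    rw [← this]
    infer_instance
  refine metrizableSpace_of_isCountablyGenerated ?_
  have h1 := (Homeomorph.mulLeft x⁻¹).map_nhds_eq x
  simp only [Homeomorph.coe_mulLeft, inv_mul_cancel] at h1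
  rw [← h1]
  infer_instance

/-- The translates of the `K n` by representatives `F` of the open subgroup determine the topology,
because every convergent sequence is eventually in one of them. -/
theorem kness_le_boundednessIndex [Infinite G] : kness G ≤ boundednessIndex G := by
  obtain ⟨F, hF, hFK⟩ := exists_cover_of_boundednessIndex hK.isOpen_iUnion
    ⟨1, mem_iUnion.2 ⟨0, hK.one_mem 0⟩⟩
  let c : F × ℕ → Set G := fun p => (p.1 : G) • K p.2
  have hcomp : ∀ p, IsCompact (c p) := fun p => (hK.isCompact p.2).smul (p.1 : G)
  have hle : kness G ≤ #(range c) := by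
    refine csInf_le' ⟨range c, ?_, ?_, fun A => ⟨fun hA C _ => hA.preimage continuous_subtype_val,
      fun hA => IsSeqClosed.isClosed fun a x ha hx => ?_⟩, rfl⟩
    · rintro _ ⟨p, rfl⟩
      exact hcomp p
    · refine eq_univ_of_forall fun g => ?_
      obtain ⟨f, hf, h, hh, rfl⟩ : g ∈ Set.image2 (fun x y => x * y) F (⋃ n, K n) :=
        hFK ▸ mem_univ g
      obtain ⟨n, hn⟩ := mem_iUnion.1 hh
      exact ⟨_, ⟨(⟨f, hf⟩, n), rfl⟩, smul_mem_smul_set hn⟩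
    · obtain ⟨f, hf, h, hh, rfl⟩ : x ∈ Set.image2 (fun x y => x * y) F (⋃ n, K n) :=
        hFK ▸ mem_univ x
      obtain ⟨n, hn⟩ := mem_iUnion.1 hh
      obtain ⟨m, hm⟩ := hK.eventually_mem_of_tendsto hn (a := fun j => f⁻¹ * a j)
        (by simpa using hx.const_mul f⁻¹)
      have hcl : IsClosed (c (⟨f, hf⟩, m) ∩ A) := by
        rw [← Subtype.image_preimage_coe]
        exact (hcomp _).isClosed.isClosedEmbedding_subtypeVal.isClosedMap _ (hA _ ⟨_, rfl⟩)
      refine (hcl.mem_of_tendsto hx (hm.mono fun j hj => ⟨?_, ha j⟩)).2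
      exact ⟨_, hj, by simp⟩
  have hinf : ℵ₀ ≤ boundednessIndex G := aleph0_le_boundednessIndex
  calc kness G ≤ #(range c) := hle
    _ ≤ #(F × ℕ) := Cardinal.mk_range_le
    _ = #F * ℵ₀ := by simp
    _ ≤ boundednessIndex G * boundednessIndex G := mul_le_mul' hF hinf
    _ = boundednessIndex G := Cardinal.mul_eq_self hinf

/-- An uncountable compact metrizable `K n` would contain an injective image of `ℕ → Bool`. So the
open subgroup is countable and its translates by `F` cover `G`. -/
theorem card_le_boundednessIndex [Infinite G] (hG : #G < 2 ^ ℵ₀) : #G ≤ boundednessIndex G := by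
  have hcount : (⋃ n, K n).Countable := by
    refine countable_iUnion fun n => ?_
    by_contra hunc
    have := hK.metrizableSpace n
    have := isCompact_iff_compactSpace.1 (hK.isCompact n)
    let _ := TopologicalSpace.metrizableSpaceMetric (K n)
    obtain ⟨f, -, -, hf⟩ := (isClosed_univ (X := K n)).exists_nat_bool_injection_of_not_countable
      fun h => hunc (countable_univ_iff.1 h).to_set
    have h1 := Cardinal.mk_le_of_injective
      (f := fun x : ULift.{u} (ℕ → Bool) => ((f x.down : K n) : G))
      (Subtype.val_injective.comp (hf.comp ULift.down_injective))
    simp only [Cardinal.mk_uLift, Cardinal.mk_pi, Cardinal.mk_bool, Cardinal.prod_const,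
      Cardinal.mk_nat, Cardinal.lift_power, Cardinal.lift_aleph0, Cardinal.lift_ofNat] at h1
    exact absurd hG h1.not_gt
  obtain ⟨F, hF, hFK⟩ := exists_cover_of_boundednessIndex hK.isOpen_iUnion
    ⟨1, mem_iUnion.2 ⟨0, hK.one_mem 0⟩⟩
  have hinf : ℵ₀ ≤ boundednessIndex G := aleph0_le_boundednessIndex
  have hsurj : Function.Surjective
      fun p : F × (⋃ n, K n : Set G) => (p.1 : G) * (p.2 : G) := by
    intro g
    obtain ⟨f, hf, h, hh, rfl⟩ : g ∈ Set.image2 (fun x y => x * y) F (⋃ n, K n) :=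
      hFK ▸ mem_univ g
    exact ⟨(⟨f, hf⟩, ⟨h, hh⟩), rfl⟩
  calc #G ≤ #(F × (⋃ n, K n : Set G)) := Cardinal.mk_le_of_surjective hsurj
    _ = #F * #(⋃ n, K n : Set G) := by simp
    _ ≤ boundednessIndex G * boundednessIndex G :=
      mul_le_mul' hF ((Cardinal.le_aleph0_iff_set_countable.2 hcount).trans hinf)
    _ = boundednessIndex G := Cardinal.mul_eq_self hinf

omit [T1Space G] in
/-- For every sequence of neighbourhoods `U n` of `1`, the intersection of the sets `K n * U n` is
a neighbourhood of `1`. -/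
theorem exists_nhds_one_subset_mul {U : ℕ → Set G} (hU : ∀ n, U n ∈ 𝓝 (1 : G)) :
    ∃ O ∈ 𝓝 (1 : G), ∀ n, O ⊆ K n * U n := by
  have hsplit : ∀ W : {W : Set G // W ∈ 𝓝 (1 : G)}, ∃ V ∈ 𝓝 (1 : G), V * V ⊆ W.1 := by
    intro W
    obtain ⟨V, hV, h⟩ := exists_nhds_one_split W.2
    exact ⟨V, hV, mul_subset_iff.2 h⟩
  choose g hg hgW using hsplit
  let V' : ℕ → {W : Set G // W ∈ 𝓝 (1 : G)} := fun n =>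
    Nat.rec ⟨U 0, hU 0⟩ (fun n W => ⟨g W ∩ U (n + 1), inter_mem (hg W) (hU (n + 1))⟩) n
  let V : ℕ → Set G := fun n => (V' n).1
  have hV : ∀ n, V n ∈ 𝓝 (1 : G) := fun n => (V' n).2
  have hV1 : ∀ n, (1 : G) ∈ V n := fun n => mem_of_mem_nhds (hV n)
  have hVU : ∀ n, V n ⊆ U n := by
    rintro (_ | n)
    · exact Subset.rfl
    · exact inter_subset_right
  have hVV : ∀ n, V (n + 1) * V (n + 1) ⊆ V n := fun n =>
    (mul_subset_mul inter_subset_left inter_subset_left).trans (hgW (V' n))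
  -- The union of the `C n` is open because a convergent sequence is eventually in one `K m`. Since
  -- `V (n + 1) * V (n + 1) ⊆ V n`, the factors telescope into `K n * V n`.
  let C : ℕ → Set G := fun n => Nat.rec {1} (fun n A => (A * V (n + 1)) ∩ K (n + 1)) n
  have hCK : ∀ n, C n ⊆ K n := by
    rintro (_ | n)
    · rintro x rfl
      exact hK.one_mem 0
    · exact inter_subset_right
  have hCmono : Monotone C := monotone_nat_of_le_succ fun n x hx =>
    ⟨⟨x, hx, 1, hV1 (n + 1), mul_one x⟩, hK.monotone n.le_succ (hCK n hx)⟩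
  have hCV : ∀ n N, n ≤ N → C N * V N ⊆ K n * V n := by
    intro n N h
    induction N, h using Nat.le_induction with
    | base => exact mul_subset_mul_right (hCK n)
    | succ N h ih =>
      calc C (N + 1) * V (N + 1) ⊆ C N * V (N + 1) * V (N + 1) :=
            mul_subset_mul_right inter_subset_left
        _ ⊆ C N * V N := by
            rw [mul_assoc]
            exact mul_subset_mul_left (hVV N)
        _ ⊆ _ := ih
  have hO : IsOpen (⋃ n, C n) := by
    refine isOpen_of_forall_tendsto fun x hx a ha => ?_
    obtain ⟨n, hn⟩ := mem_iUnion.1 hx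
    obtain ⟨m, hm⟩ := hK.eventually_mem_of_tendsto (hCK n hn) ha
    have h1 : Tendsto (fun j => x⁻¹ * a j) atTop (𝓝 1) := by simpa using ha.const_mul x⁻¹
    filter_upwards [hm, h1.eventually_mem (hV (max n m + 1))] with j hj hjV
    refine mem_iUnion.2 ⟨max n m + 1, ⟨x, hCmono (le_max_left _ _) hn, _, hjV, by simp⟩, ?_⟩
    exact hK.monotone (by omega) hj
  refine ⟨⋃ n, C n, hO.mem_nhds (mem_iUnion.2 ⟨0, rfl⟩), fun n x hx => ?_⟩
  obtain ⟨N, hN⟩ := mem_iUnion.1 hx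
  exact mul_subset_mul_left (hVU n) (hCV n (max n N) (le_max_left _ _)
    ⟨x, hCmono (le_max_right _ _) hN, 1, hV1 (max n N), mul_one x⟩)

omit [T1Space G] in
theorem isWeilComplete : IsWeilComplete G := by
  let _ : UniformSpace G := IsTopologicalGroup.leftUniformSpace G
  refine CompleteSpace.mk fun {f} hf => ?_
  have hsmall : ∀ O ∈ 𝓝 (1 : G), ∃ A ∈ f, ∀ x ∈ A, ∀ y ∈ A, x⁻¹ * y ∈ O := by
    intro O hO
    have h1 : (fun p : G × G => p.1⁻¹ * p.2) ⁻¹' O ∈ f ×ˢ f := hf.2 (preimage_mem_comap hO)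
    obtain ⟨A, hA, hAO⟩ := mem_prod_self_iff.1 h1
    exact ⟨A, hA, fun x hx y hy => hAO (mk_mem_prod hx hy)⟩
  have := hf.1
  by_contra! hlim
  obtain ⟨A₀, hA₀, hA₀K⟩ := hsmall _ (hK.isOpen_iUnion.mem_nhds
    (mem_iUnion.2 ⟨0, hK.one_mem 0⟩))
  obtain ⟨x₀, hx₀⟩ := Filter.nonempty_of_mem hA₀
  have hU : ∀ n, ∃ U ∈ 𝓝 (1 : G), ((x₀ • K n) * U)ᶜ ∈ f := by
    intro n
    have hcomp : IsCompact (x₀ • K n) := (hK.isCompact n).smul x₀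
    have hdisj : Disjoint (𝓝ˢ (x₀ • K n)) f := hcomp.disjoint_nhdsSet_left.2 fun x _ => by
      rw [disjoint_iff]
      by_contra hne
      exact hlim x (le_nhds_of_cauchy_adhp hf ⟨hne⟩)
    obtain ⟨S, hS, T, hT, hST⟩ := Filter.disjoint_iff.1 hdisj
    obtain ⟨O, hO, hKO, hOS⟩ := mem_nhdsSet_iff_exists.1 hS
    obtain ⟨U, hU, hKU⟩ := compact_open_separated_mul_right hcomp hO hKO
    exact ⟨U, hU, mem_of_superset hT fun t ht h => hST.ne_of_mem (hOS (hKU h)) ht rfl⟩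
  choose U hU hUf using hU
  -- A Cauchy filter without limit misses a neighbourhood `x₀ • K n * U n` of each compact set. The
  -- shift to `n + 1` absorbs the product `K n * K n ⊆ K (n + 1)`.
  obtain ⟨O, hO, hOK⟩ := hK.exists_nhds_one_subset_mul fun n => hU (n + 1)
  obtain ⟨A, hA, hAO⟩ := hsmall O hO
  obtain ⟨x, hxA, hxA₀⟩ := Filter.nonempty_of_mem (inter_mem hA hA₀)
  obtain ⟨n, hn⟩ := mem_iUnion.1 (hA₀K _ hx₀ _ hxA₀)
  obtain ⟨y, hyA, hy⟩ := Filter.nonempty_of_mem (inter_mem hA (hUf (n + 1)))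
  obtain ⟨k, hk, v, hv, hkv⟩ := hOK n (hAO x hxA y hyA)
  refine hy ⟨x₀ * (x₀⁻¹ * x * k), smul_mem_smul_set (hK.mul_mem n _ hn k hk), v, hv, ?_⟩
  have hkv : k * v = x⁻¹ * y := hkv
  calc x₀ * (x₀⁻¹ * x * k) * v = x * (k * v) := by group
    _ = y := by rw [hkv]; group

end IsExhaustion

end Consequences

/-! ### Sequential order at least `ω₁` -/

section SequentialOrder

section Iter

variable {X : Type u} [TopologicalSpace X]

theorem mem_iterSeqClosure {A : Set X} {α : Ordinal.{u}} {x : X} :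
    x ∈ iterSeqClosure A α ↔ x ∈ A ∨ ∃ β < α, x ∈ seqClosure (iterSeqClosure A β) := by
  rw [iterSeqClosure]
  simp

theorem subset_iterSeqClosure (A : Set X) (α : Ordinal.{u}) : A ⊆ iterSeqClosure A α :=
  fun _ hx => mem_iterSeqClosure.2 (Or.inl hx)

theorem iterSeqClosure_zero (A : Set X) : iterSeqClosure A 0 = A := by
  ext x
  simp [mem_iterSeqClosure]

theorem seqClosure_iterSeqClosure_subset (A : Set X) {β α : Ordinal.{u}} (h : β < α) :
    seqClosure (iterSeqClosure A β) ⊆ iterSeqClosure A α :=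
  fun _ hx => mem_iterSeqClosure.2 (Or.inr ⟨β, h, hx⟩)

theorem iterSeqClosure_mono (A : Set X) : Monotone (iterSeqClosure A) := by
  intro α β h x hx
  rcases mem_iterSeqClosure.1 hx with hx | ⟨γ, hγ, hx⟩
  · exact subset_iterSeqClosure A β hx
  · exact seqClosure_iterSeqClosure_subset A (hγ.trans_le h) hx

theorem map_mem_iterSeqClosure {Y : Type u} [TopologicalSpace Y] {f : X → Y} (hf : Continuous f)
    (A : Set X) (α : Ordinal.{u}) :
    ∀ x ∈ iterSeqClosure A α, f x ∈ iterSeqClosure (f '' A) α := by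
  induction α using WellFoundedLT.induction with
  | ind α ih =>
    intro x hx
    rcases mem_iterSeqClosure.1 hx with hx | ⟨β, hβ, t, ht, htx⟩
    · exact subset_iterSeqClosure _ _ (mem_image_of_mem f hx)
    · exact seqClosure_iterSeqClosure_subset _ hβ
        ⟨fun j => f (t j), fun j => ih β hβ _ (ht j), (hf.tendsto x).comp htx⟩

theorem iterSeqClosure_subset_closure (A : Set X) (α : Ordinal.{u}) :
    iterSeqClosure A α ⊆ closure A := by
  induction α using WellFoundedLT.induction with
  | ind α ih =>
    intro x hx
    rcases mem_iterSeqClosure.1 hx with hx | ⟨β, hβ, t, ht, htx⟩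
    · exact subset_closure hx
    · exact isClosed_closure.isSeqClosed (fun j => ih β hβ (ht j)) htx

/-- The countably many ranks of the terms of a sequence are bounded below `ω₁`. This makes the
infimum defining `seqOrder` attained. -/
theorem iterSeqClosure_omega_one_add_one (A : Set X) :
    iterSeqClosure A (ω₁ + 1) = iterSeqClosure A ω₁ := by
  refine Subset.antisymm (fun x hx => ?_) (iterSeqClosure_mono A (le_self_add))
  rcases mem_iterSeqClosure.1 hx with hx | ⟨β, hβ, t, ht, htx⟩
  · exact subset_iterSeqClosure A _ hx
  have hβ' : β ≤ ω₁ := Order.lt_add_one_iff.1 hβ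
  have hlim : Order.IsSuccLimit (ω₁ : Ordinal.{u}) := Cardinal.isSuccLimit_omega 1
  have hγ : ∀ j, ∃ γ < (ω₁ : Ordinal.{u}), t j ∈ iterSeqClosure A γ := by
    intro j
    rcases mem_iterSeqClosure.1 (iterSeqClosure_mono A hβ' (ht j)) with h | ⟨δ, hδ, h⟩
    · exact ⟨0, Ordinal.omega_pos 1, subset_iterSeqClosure A _ h⟩
    · exact ⟨Order.succ δ, hlim.succ_lt hδ,
        seqClosure_iterSeqClosure_subset A (Order.lt_succ δ) h⟩
  choose γ hγ htγ using hγ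
  refine seqClosure_iterSeqClosure_subset A (Ordinal.iSup_lt_omega_one hγ) ⟨t, fun j => ?_, htx⟩
  exact iterSeqClosure_mono A (Ordinal.le_iSup γ j) (htγ j)

theorem iterSeqClosure_seqOrder (A : Set X) :
    iterSeqClosure A (seqOrder X + 1) = iterSeqClosure A (seqOrder X) := by
  have h : seqOrder X ∈ {α | ∀ A : Set X, iterSeqClosure A (α + 1) = iterSeqClosure A α} :=
    csInf_mem ⟨ω₁, iterSeqClosure_omega_one_add_one⟩
  exact h A

theorem closure_subset_iterSeqClosure_seqOrder [SequentialSpace X] (A : Set X) :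
    closure A ⊆ iterSeqClosure A (seqOrder X) := by
  refine closure_minimal (subset_iterSeqClosure A _) (IsSeqClosed.isClosed fun t x ht hx => ?_)
  rw [← iterSeqClosure_seqOrder]
  exact seqClosure_iterSeqClosure_subset A (lt_add_one _) ⟨t, ht, hx⟩

end Iter

theorem exists_seq_cofinal {α : Ordinal.{u}} (h0 : 0 < α) (hα : α < ω₁) :
    ∃ β : ℕ → Ordinal.{u}, (∀ n, β n < α) ∧ ∀ δ < α, ∀ᶠ n in atTop, δ ≤ β n := by
  have hcount : (Iio α).Countable := by
    rw [← Cardinal.le_aleph0_iff_set_countable, Cardinal.mk_Iio_ordinal, Cardinal.lift_le_aleph0,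
      ← Cardinal.lt_aleph_one_iff, ← Cardinal.lt_ord, Cardinal.ord_aleph]
    exact hα
  obtain ⟨e, he⟩ := hcount.exists_eq_range ⟨0, h0⟩
  have hlt : ∀ n, e n < α := fun n => by
    have : e n ∈ Iio α := he ▸ mem_range_self n
    exact this
  refine ⟨fun n => (Finset.range (n + 1)).sup e, fun n => ?_, fun δ hδ => ?_⟩
  · exact (Finset.sup_lt_iff (bot_lt_of_lt h0)).2 fun i _ => hlt i
  · obtain ⟨i, rfl⟩ : δ ∈ range e := he ▸ hδ
    filter_upwards [eventually_ge_atTop i] with n hn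
    exact Finset.le_sup (Finset.mem_range.2 (Nat.lt_succ_of_le hn))

variable {G : Type u} [Group G] [TopologicalSpace G] [IsTopologicalGroup G] [T1Space G]
  [SequentialSpace G]

omit [T1Space G] in
theorem IsFan.exists_tendsto_notMem {s : ℕ → ℕ → G} (hs : IsFan s) {K : ℕ → Set G}
    (hK : IsExhaustion K) (m : ℕ) :
    ∃ a : ℕ → G, Tendsto a atTop (𝓝 1) ∧ ∀ n, a n ∉ K m ∧ a n ∈ ⋃ n, K n := by
  obtain ⟨k, hk⟩ : ∃ k, ∀ c, s k c ∉ K m := by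
    by_contra! hc
    choose c hc using hc
    obtain ⟨y, -, φ, hφ, hy⟩ := hK.isSeqCompact m hc
    exact hs.not_tendsto (c ∘ φ) y hφ hy
  obtain ⟨c₀, hc₀⟩ := eventually_atTop.1 ((hs.tendsto_one k).eventually_mem
    (hK.isOpen_iUnion.mem_nhds (mem_iUnion.2 ⟨0, hK.one_mem 0⟩)))
  exact ⟨fun c => s k (c + c₀), (hs.tendsto_one k).comp (tendsto_add_atTop_nat c₀),
    fun c => ⟨hk _, hc₀ _ (Nat.le_add_left _ _)⟩⟩

/-- Sets with large sequential order at `1` are glued along a sequence converging to `1`. -/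
theorem IsExhaustion.notMem_iterSeqClosure_iUnion {K : ℕ → Set G} (hK : IsExhaustion K) {m : ℕ}
    {a : ℕ → G} (ha : Tendsto a atTop (𝓝 1)) (haK : ∀ n, a n ∉ K m) {A : ℕ → Set G}
    (hAH : ∀ n, A n ⊆ ⋃ n, K n) (haA : ∀ n, a n ∈ closure (A n))
    (hAK : ∀ n, closure (A n) ∩ K (m + n) ⊆ {a n}) :
    closure (⋃ n, A n) ∩ K m ⊆ {1} ∧ 1 ∈ closure (⋃ n, A n) ∧
      ∀ α : Ordinal.{u}, (∀ δ < α, ∀ᶠ n in atTop, a n ∉ iterSeqClosure (A n) δ) →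
        1 ∉ iterSeqClosure (⋃ n, A n) α := by
  have hclH : ∀ n, closure (A n) ⊆ ⋃ n, K n := fun n =>
    closure_minimal (hAH n) hK.isClosed_iUnion
  have hdisj : ∀ n, ∀ x ∈ closure (A n), x ∉ K m := by
    intro n x hx hxm
    have : x = a n := hAK n ⟨hx, hK.monotone (Nat.le_add_right m n) hxm⟩
    exact haK n (this ▸ hxm)
  -- The limit lies in the clopen subgroup, so the sequence is eventually in one `K p`, where for
  -- large indices `closure (A n)` has at most the point `a n`.
  have hkey : ∀ (ν : ℕ → ℕ) (t : ℕ → G) (x : G), StrictMono ν → (∀ j, t j ∈ closure (A (ν j))) →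
      Tendsto t atTop (𝓝 x) → ∀ᶠ j in atTop, t j = a (ν j) := by
    intro ν t x hν ht hx
    obtain ⟨n, hn⟩ := mem_iUnion.1
      (hK.isClosed_iUnion.mem_of_tendsto hx (Eventually.of_forall fun j => hclH _ (ht j)))
    obtain ⟨p, hp⟩ := hK.eventually_mem_of_tendsto hn hx
    filter_upwards [hp, hν.tendsto_atTop.eventually_ge_atTop p] with j hj hpj
    exact hAK _ ⟨ht j, hK.monotone (by omega) hj⟩
  have hclosed : IsClosed ({1} ∪ ⋃ n, closure (A n)) := by
    refine IsSeqClosed.isClosed fun t x ht hx => ?_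
    by_cases h1 : ∃ᶠ j in atTop, t j ∈ ({1} : Set G)
    · refine Or.inl (by_contra fun hne => h1 ?_)
      exact hx.eventually_mem (isClosed_singleton.isOpen_compl.mem_nhds hne)
    obtain ⟨φ, hφ, ht'⟩ := extraction_of_eventually_atTop (not_frequently.1 h1)
    choose ν hν using fun j => mem_iUnion.1 ((ht (φ j)).resolve_left (ht' j))
    have hx' := hx.comp hφ.tendsto_atTop
    obtain ⟨ψ, hψ, hνψ⟩ | ⟨c, ψ, hψ, hc⟩ := exists_strictMono_comp_or_const ν
    · have heq := hkey _ (fun j => t (φ (ψ j))) x hνψ (fun j => hν _) (hx'.comp hψ.tendsto_atTop)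
      exact Or.inl (tendsto_nhds_unique (hx'.comp hψ.tendsto_atTop)
        ((ha.comp hνψ.tendsto_atTop).congr' (heq.mono fun j hj => hj.symm)))
    · refine Or.inr (mem_iUnion.2 ⟨c, isClosed_closure.isSeqClosed (fun j => ?_)
        (hx'.comp hψ.tendsto_atTop)⟩)
      rw [← hc j]
      exact hν _
  have hsub : closure (⋃ n, A n) ⊆ {1} ∪ ⋃ n, closure (A n) :=
    closure_minimal (iUnion_subset fun n => (subset_closure.trans
      (subset_iUnion (fun n => closure (A n)) n)).trans subset_union_right) hclosed
  refine ⟨?_, ?_, fun α hα h1 => ?_⟩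
  · rintro x ⟨hx, hxm⟩
    refine (hsub hx).resolve_right fun h => ?_
    obtain ⟨n, hn⟩ := mem_iUnion.1 h
    exact hdisj n x hn hxm
  · exact isClosed_closure.mem_of_tendsto ha (Eventually.of_forall fun n =>
      closure_mono (subset_iUnion A n) (haA n))
  · have claim : ∀ γ ≤ α, iterSeqClosure (⋃ n, A n) γ ⊆ ⋃ n, iterSeqClosure (A n) γ := by
      intro γ
      induction γ using WellFoundedLT.induction with
      | ind γ ih =>
        intro hγ x hx
        rcases mem_iterSeqClosure.1 hx with hx | ⟨δ, hδ, t, ht, htx⟩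
        · obtain ⟨n, hn⟩ := mem_iUnion.1 hx
          exact mem_iUnion.2 ⟨n, subset_iterSeqClosure _ _ hn⟩
        choose ν hν using fun j => mem_iUnion.1 (ih δ hδ (hδ.le.trans hγ) (ht j))
        obtain ⟨ψ, hψ, hνψ⟩ | ⟨c, ψ, hψ, hc⟩ := exists_strictMono_comp_or_const ν
        · have heq := hkey _ (fun j => t (ψ j)) x hνψ
            (fun j => iterSeqClosure_subset_closure _ _ (hν _)) (htx.comp hψ.tendsto_atTop)
          obtain ⟨j, hj, hj'⟩ := (heq.and
            (hνψ.tendsto_atTop.eventually (hα δ (hδ.trans_le hγ)))).exists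
          exact (hj' (hj ▸ hν (ψ j))).elim
        · refine mem_iUnion.2 ⟨c, seqClosure_iterSeqClosure_subset _ hδ
            ⟨t ∘ ψ, fun j => ?_, htx.comp hψ.tendsto_atTop⟩⟩
          rw [← hc j]
          exact hν _
    obtain ⟨n, hn⟩ := mem_iUnion.1 (claim α le_rfl h1)
    exact hdisj n 1 (iterSeqClosure_subset_closure _ _ hn) (hK.one_mem m)

/-- Induction on `α`: translates of sets of order beyond `β n` are glued at the points `a n` of a
sequence tending to `1`, with `β n` eventually above every ordinal less than `α`. Keeping the
closure off `K m` apart from `1`, for every `m`, is what makes the gluing possible. -/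
theorem IsFan.exists_notMem_iterSeqClosure {s : ℕ → ℕ → G} (hs : IsFan s) {K : ℕ → Set G}
    (hK : IsExhaustion K) (α : Ordinal.{u}) : α < ω₁ → ∀ m, ∃ A : Set G, A ⊆ ⋃ n, K n ∧
      closure A ∩ K m ⊆ {1} ∧ 1 ∈ closure A ∧ 1 ∉ iterSeqClosure A α := by
  induction α using WellFoundedLT.induction with
  | ind α ih =>
    intro hα m
    obtain ⟨a, ha, haK⟩ := hs.exists_tendsto_notMem hK m
    rcases eq_or_ne α 0 with rfl | h0
    · have hcl : closure (range a) ⊆ insert 1 (range a) :=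
        closure_minimal (subset_insert _ _) ha.isCompact_insert_range.isClosed
      refine ⟨range a, ?_, ?_, ?_, ?_⟩
      · rintro _ ⟨n, rfl⟩
        exact (haK n).2
      · rintro x ⟨hx, hxm⟩
        rcases hcl hx with h | ⟨n, rfl⟩
        · exact h
        · exact ((haK n).1 hxm).elim
      · exact mem_closure_of_tendsto ha (Eventually.of_forall fun n => mem_range_self n)
      · rw [iterSeqClosure_zero]
        rintro ⟨n, hn⟩
        exact (haK n).1 (hn ▸ hK.one_mem m)
    · obtain ⟨β, hβ, hβα⟩ := exists_seq_cofinal (pos_iff_ne_zero.2 h0) hα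
      choose p hp using fun n => mem_iUnion.1 (haK n).2
      -- With `a n ∈ K (p n)`, the index `max (p n) (m + n) + 1` ensures that `(a n)⁻¹ * x` is in
      -- the avoided level for all `x ∈ K (m + n)`.
      choose B hBH hBK hB1 hBβ using fun n =>
        ih (β n) (hβ n) ((hβ n).trans hα) (max (p n) (m + n) + 1)
      have hcl : ∀ n, ∀ x ∈ closure (a n • B n), (a n)⁻¹ * x ∈ closure (B n) := by
        intro n x hx
        refine map_mem_closure (continuous_const_mul (a n)⁻¹) hx ?_
        rintro _ ⟨y, hy, rfl⟩
        simpa using hy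
      have hBK' : ∀ n, a n • B n ⊆ ⋃ n, K n := by
        rintro n _ ⟨y, hy, rfl⟩
        obtain ⟨q, hq⟩ := mem_iUnion.1 (hBH n hy)
        exact mem_iUnion.2 ⟨max (p n) q + 1, hK.mul_mem _ _
          (hK.monotone (le_max_left _ _) (hp n)) _ (hK.monotone (le_max_right _ _) hq)⟩
      have haB : ∀ n, a n ∈ closure (a n • B n) := by
        intro n
        have := map_mem_closure (continuous_const_mul (a n)) (hB1 n)
          (t := a n • B n) fun y hy => smul_mem_smul_set hy
        simpa using this
      have hBa : ∀ n, closure (a n • B n) ∩ K (m + n) ⊆ {a n} := by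
        rintro n x ⟨hx, hxK⟩
        have : (a n)⁻¹ * x = 1 := hBK n ⟨hcl n x hx, hK.mul_mem _ _
          (hK.inv_mem _ _ (hK.monotone (le_max_left _ _) (hp n))) _
          (hK.monotone (le_max_right _ _) hxK)⟩
        exact (inv_mul_eq_one.1 this).symm
      obtain ⟨h1, h2, h3⟩ := hK.notMem_iterSeqClosure_iUnion ha (fun n => (haK n).1) hBK' haB hBa
      refine ⟨⋃ n, a n • B n, iUnion_subset hBK', h1, h2, h3 α fun δ hδ => ?_⟩
      filter_upwards [hβα δ hδ] with n hn hmem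
      refine hBβ n (iterSeqClosure_mono _ hn ?_)
      have := map_mem_iterSeqClosure (continuous_const_mul (a n)⁻¹) _ _ _ hmem
      rw [← image_smul, image_image] at this
      simpa using this

theorem IsFan.omega_one_le_seqOrder {s : ℕ → ℕ → G} (hs : IsFan s) {K : ℕ → Set G}
    (hK : IsExhaustion K) : ω₁ ≤ seqOrder G := by
  by_contra! h
  obtain ⟨A, -, -, h1, h2⟩ := hs.exists_notMem_iterSeqClosure hK _ h 0
  exact h2 (closure_subset_iterSeqClosure_seqOrder A h1)

end SequentialOrder

end SeqGroup

theorem theorem3 {G : Type u} [Group G] [TopologicalSpace G] [IsTopologicalGroup G]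
    [T1Space G] [SequentialSpace G]
    (hcs : SeqGroup.csStarCharacter G ≤ ℵ₀)
    (h : SeqGroup.seqOrder G < ω₁ ∨
      SeqGroup.sbCharacter G < Cardinal.lift.{u} SeqGroup.dominatingNumber ∨
      SeqGroup.boundednessIndex G < SeqGroup.kness G ∨
      FrechetUrysohnSpace G ∨
      SeqGroup.IsAlphaSeven G ∨
      (¬ SeqGroup.HasClosedCopy SeqGroup.SeqFan G ∨
        ¬ SeqGroup.HasClosedCopy SeqGroup.ArensSpace G) ∨
      ¬ SeqGroup.IsWeilComplete G ∨
      BaireSpace G ∨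
      (SeqGroup.boundednessIndex G < #G ∧ #G < 2 ^ ℵ₀)) :
    TopologicalSpace.MetrizableSpace G := by
  by_contra hG
  obtain ⟨N, hN⟩ := SeqGroup.exists_isCsStarNetworkAt hcs 1
  obtain ⟨s, hs⟩ := SeqGroup.exists_isFan_of_not_metrizableSpace hN hG
  obtain ⟨K, hK⟩ := hs.exists_isExhaustion hN
  have : Infinite G := Infinite.of_injective (s 0) fun i j hij => (hs.injective hij).2
  rcases h with h | h | h | h | h | (h | h) | h | h | ⟨h, h'⟩
  · exact h.not_ge (hs.omega_one_le_seqOrder hK)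
  · exact h.not_ge hs.dominatingNumber_le_sbCharacter
  · exact h.not_ge hK.kness_le_boundednessIndex
  · exact hs.not_frechetUrysohnSpace h
  · exact hs.not_isAlphaSeven h
  · exact h hs.hasClosedCopy_seqFan
  · exact h hs.exists_isClosedEmbedding_arensSpace
  · exact h hK.isWeilComplete
  · exact hG hK.metrizableSpace_of_baireSpace
  · exact h.not_ge (hK.card_le_boundednessIndex h')
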